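/- Let $(V,M_V)$ be a discrete valuation ring with normalized valuation $\mathbf v$, and let $(R,M_R)$ be a Noetherian local subring of $V$ such that $R$ and $V$ have the same quotient field $K$, $V$ is the integral closure of $R$, the conductor $(R:V)=\{x\in K\mid xV\subseteq R\}$ is nonzero, and the inclusion $R\hookrightarrow V$ induces an isomorphism of residue fields $R/M_R\to V/M_V$. Call $R$ a Kunz domain if the numerical semigroup $\mathbf v(R)=\{\mathbf v(r)\mid r\in R\setminus\{0\}\}$ is pseudo-symmetric, i.e., $g:=\sup(\mathbb Z\setminus \mathbf v(R))$ is even and, for every $a\in\mathbb N$ with $a\neq g/2$, either $a\in \mathbf v(R)$ or $g-a\in \mathbf v(R)$. Let $\mathcal F(R)$ be the set of fractional ideals of $R$ (the $R$-submodules $I$ of $K$ such that $xI\subseteq R$ for some $x\in K\setminus\{0\}$). A star operation on $R$ is a map $\star:\mathcal F(R)\to\mathcal F(R)$, $I\mapsto I^\star$, such that, for all $I,J\in\mathcal F(R)$ and $x\in K$: $I\subseteq I^\star$; $I\subseteq J$ implies $I^\star\subseteq J^\star$; $(I^\star)^\star=I^\star$; $x\cdot I^\star=(xI)^\star$; and $R^\star=R$.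 Let $\mathrm{Star}(R)$ be the set of star operations on $R$. **Proposition.** Let $R$ be a Kunz domain such that $\mathbf v(R)=\langle 4,5,7\rangle=\{4a+5b+7c\mid a,b,c\in\mathbb N\}$, and suppose that the residue field of $R$ has finite cardinality $q$. Then $\mathrm{Star}(R)$ is finite and $$|\mathrm{Star}(R)|=2^{2q}+3.$$ -/

import Mathlib

open scoped nonZeroDivisors

/-- A star operation on a domain `D` with quotient field `K`. Mathlib's `FractionalIdeal D⁰ K` is the
type of all `D`-submodules `I` of `K` with `d I ⊆ D` for some `d ≠ 0` (the zero module included), and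
`FractionalIdeal.spanSingleton D⁰ x * I` is the fractional ideal `x I`. -/
@[ext]
structure StarOperation (D K : Type*) [CommRing D] [IsDomain D] [Field K] [Algebra D K]
    [IsFractionRing D K] where
  /-- The map `I ↦ I^⋆`. -/
  star : FractionalIdeal D⁰ K → FractionalIdeal D⁰ K
  le_star : ∀ I, I ≤ star I
  star_mono : ∀ I J, I ≤ J → star I ≤ star J
  star_star : ∀ I, star (star I) = star I
  smul_star : ∀ (x : K) (I), FractionalIdeal.spanSingleton D⁰ x * star I =
    star (FractionalIdeal.spanSingleton D⁰ x * I)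
  star_one : star 1 = 1

/-- `g(S) = sup (ℤ \ S)`. -/
noncomputable def frobeniusNum (S : AddSubmonoid ℕ) : ℤ :=
  sSup {z : ℤ | ¬ ∃ s ∈ S, (s : ℤ) = z}

/-- A numerical semigroup `S` is pseudo-symmetric if `g = g(S)` is even and, for every `a ∈ ℕ` with
`a ≠ g / 2`, either `a ∈ S` or `g - a ∈ S`. -/
structure IsPseudoSymmetric (S : AddSubmonoid ℕ) : Prop where
  finite_compl : ((S : Set ℕ)ᶜ).Finite
  even : Even (frobeniusNum S)
  mem_or_mem : ∀ a : ℕ, 2 * (a : ℤ) ≠ frobeniusNum S →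
    a ∈ S ∨ ∃ s ∈ S, (s : ℤ) = frobeniusNum S - a

/-- The set of values `v(r)`, `r ∈ R \ {0}`, where `v` is the normalized valuation of the discrete
valuation ring `V ⊇ R`. (The value `v(0) = ∞` is not a natural number.) -/
noncomputable def valueSemigroup (R V : Type*) [CommRing R] [CommRing V] [IsDomain V]
    [IsDiscreteValuationRing V] [Algebra R V] : AddSubmonoid ℕ where
  carrier := {n | ∃ r : R, IsDiscreteValuationRing.addVal V (algebraMap R V r) = (n : ℕ∞)}
  zero_mem' := ⟨1, by simp⟩
  add_mem' := by
    rintro m n ⟨r, hr⟩ ⟨s, hs⟩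
    exact ⟨r * s, by rw [map_mul, IsDiscreteValuationRing.addVal_mul, hr, hs]; push_cast; rfl⟩

/-- `R` is a Kunz domain with associated discrete valuation ring `V` and quotient field `K`. -/
structure IsKunzDomain (R V K : Type*) [CommRing R] [IsDomain R] [IsLocalRing R]
    [CommRing V] [IsDomain V] [IsDiscreteValuationRing V] [Field K]
    [Algebra R V] [Algebra R K] [Algebra V K] [IsScalarTower R V K] : Prop where
  /-- `R` is a subring of `V`. -/
  injective : Function.Injective (algebraMap R V)
  /-- `R` and `V` have the same quotient field, namely `K`. -/
  isFractionRing_left : IsFractionRing R K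
  isFractionRing_right : IsFractionRing V K
  /-- `V` is the integral closure of `R` in `K`. -/
  isIntegralClosure : IsIntegralClosure V R K
  isNoetherianRing : IsNoetherianRing R
  /-- The conductor `(R : V) = {x ∈ K | x V ⊆ R}` is nonzero. -/
  conductor_ne_zero : ∃ x : K, x ≠ 0 ∧
    ∀ v : V, ∃ r : R, algebraMap R K r = x * algebraMap V K v
  /-- The inclusion of `R` in `V` induces an isomorphism of residue fields. -/
  isLocalHom : IsLocalHom (algebraMap R V)
  residueField_bijective : Function.Bijective (IsLocalRing.ResidueField.map (algebraMap R V))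
  /-- The value semigroup is pseudo-symmetric. -/
  isPseudoSymmetric : IsPseudoSymmetric (valueSemigroup R V)

/-!
A star operation is determined by the nondivisorial ideals that it closes, up to homothety.
Normalize such an ideal to have least value `0`. As the value semigroup is `{0, 4, 5} ∪ [7, ∞)`,
exactly one value `g ≥ 3` is missing, it is `3` or `6`, and the divisorial closure adds only this
value. A star operation closing `J` must close `I` as soon as some multiple of `J` contains `I`
but not the divisorial closure of `I`, and this means that some element moving the missing value
of `I` to that of `J` multiplies `I` into `J`.

For `g = 6` the ideal is homothetic to `R + t³R`. For `g = 3` it contains all elements of order at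
least `4`, and modulo these it is a line, a plane or a hyperplane not meeting order `3` in the
quotient of the valuation ring. Lines and hyperplanes form one class each, and the planes with
values `{0, 1}` and those with values `{0, 2}` each form a family of classes parametrized by the
residue field, no two of which are comparable. So the classes form a poset with four levels, of
which only the second, with `2q` elements, is not a single point, each level below the next one.
Its lower sets are the `2 ^ (2q)` ones given by a set of planes, and three others.
-/

open FractionalIdeal hiding zero_le zero_mem

section DivisorialClosure

instance {R K : Type*} [CommRing R] {S : Submonoid R} [CommRing K] [Algebra R K] :
    AddSubgroupClass (FractionalIdeal S K) K where
  add_mem {I} _ _ := (I : Submodule R K).add_mem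
  zero_mem I := (I : Submodule R K).zero_mem
  neg_mem {I} _ := (I : Submodule R K).neg_mem

theorem algebraMap_mul_mem {R K : Type*} [CommRing R] {S : Submonoid R} [CommRing K] [Algebra R K]
    {I : FractionalIdeal S K} (r : R) {x : K} (hx : x ∈ I) : algebraMap R K r * x ∈ I :=
  Algebra.smul_def r x ▸ (I : Submodule R K).smul_mem r hx

variable {R K : Type*} [CommRing R] [Field K] [Algebra R K] [IsFractionRing R K]
  {I J : FractionalIdeal R⁰ K} {c u x : K}

theorem mem_spanSingleton_mul_iff (hc : c ≠ 0) : x ∈ spanSingleton R⁰ c * I ↔ c⁻¹ * x ∈ I := by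
  rw [mem_singleton_mul]
  constructor
  · rintro ⟨y, hy, rfl⟩
    rwa [inv_mul_cancel_left₀ hc]
  · exact fun h => ⟨_, h, by rw [mul_inv_cancel_left₀ hc]⟩

theorem spanSingleton_mul_le_iff_le_inv_mul (hc : c ≠ 0) :
    spanSingleton R⁰ c * I ≤ J ↔ I ≤ spanSingleton R⁰ c⁻¹ * J := by
  rw [spanSingleton_mul_le_iff]
  exact forall₂_congr fun y _ => by
    rw [mem_spanSingleton_mul_iff (inv_ne_zero hc), inv_inv]

theorem spanSingleton_inv_mul_cancel (hc : c ≠ 0) (I : FractionalIdeal R⁰ K) :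
    spanSingleton R⁰ c⁻¹ * (spanSingleton R⁰ c * I) = I := by
  rw [← mul_assoc, spanSingleton_mul_spanSingleton, inv_mul_cancel₀ hc, spanSingleton_one, one_mul]

theorem spanSingleton_mul_ne_zero (hc : c ≠ 0) (hI : I ≠ 0) : spanSingleton R⁰ c * I ≠ 0 :=
  fun h => hI (by rw [← spanSingleton_inv_mul_cancel hc I, h, mul_zero])

theorem spanSingleton_mul_spanSingleton_sup_le_iff :
    spanSingleton R⁰ u * (spanSingleton R⁰ x ⊔ I) ≤ J ↔
      u * x ∈ J ∧ spanSingleton R⁰ u * I ≤ J := by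
  rw [sup_eq_add, mul_add, ← sup_eq_add, sup_le_iff, spanSingleton_mul_spanSingleton,
    spanSingleton_le_iff_mem]

variable [IsDomain R]

theorem inv_ne_zero_of_ne_zero (hI : I ≠ 0) : I⁻¹ ≠ 0 := by
  obtain ⟨d, hd, hdI⟩ := I.isFractional
  have hd_mem : algebraMap R K d ∈ I⁻¹ := (mem_inv_iff hI).2 fun y hy => by
    rw [← Algebra.smul_def]
    exact (mem_one_iff _).2 (hdI y hy)
  rintro h
  rw [h, mem_zero_iff] at hd_mem
  exact nonZeroDivisors.ne_zero hd ((map_eq_zero_iff _ (IsFractionRing.injective R K)).1 hd_mem)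

theorem spanSingleton_mul_inv_eq (hc : c ≠ 0) (I : FractionalIdeal R⁰ K) :
    (spanSingleton R⁰ c * I)⁻¹ = spanSingleton R⁰ c⁻¹ * I⁻¹ := by
  rcases eq_or_ne I 0 with rfl | hI
  · simp only [mul_zero, inv_zero']
  ext z
  rw [mem_inv_iff (spanSingleton_mul_ne_zero hc hI), mem_spanSingleton_mul_iff (inv_ne_zero hc),
    mem_inv_iff hI, inv_inv]
  constructor
  · intro h y hy
    rw [mul_comm c, mul_assoc]
    exact h _ (mem_singleton_mul.2 ⟨y, hy, rfl⟩)
  · intro h x hx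
    obtain ⟨y, hy, rfl⟩ := mem_singleton_mul.1 hx
    rw [← mul_assoc, mul_comm z]
    exact h y hy

/-- The divisorial closure `I ↦ (R : (R : I))`, the largest star operation. -/
noncomputable def divClosure (I : FractionalIdeal R⁰ K) : FractionalIdeal R⁰ K := I⁻¹⁻¹

theorem divClosure_zero : divClosure (0 : FractionalIdeal R⁰ K) = 0 := by
  simp only [divClosure, inv_zero']

theorem divClosure_one : divClosure (1 : FractionalIdeal R⁰ K) = 1 := by
  simp only [divClosure, inv_eq, FractionalIdeal.div_one]

theorem mem_divClosure (hI : I ≠ 0) : x ∈ divClosure I ↔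
    ∀ z : K, spanSingleton R⁰ z * I ≤ 1 → z * x ∈ (1 : FractionalIdeal R⁰ K) := by
  simp only [divClosure, mem_inv_iff (inv_ne_zero_of_ne_zero hI), mem_inv_iff hI,
    spanSingleton_mul_le_iff, mul_comm x]

theorem le_divClosure (I : FractionalIdeal R⁰ K) : I ≤ divClosure I := by
  rcases eq_or_ne I 0 with rfl | hI
  · rw [divClosure_zero]
  · exact fun x hx => (mem_divClosure hI).2 fun z hz => spanSingleton_mul_le_iff.1 hz x hx

theorem divClosure_mono (h : I ≤ J) : divClosure I ≤ divClosure J := by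
  rcases eq_or_ne I 0 with rfl | hI
  · exact divClosure_zero.le.trans (FractionalIdeal.zero_le _)
  · have hJ : J ≠ 0 := fun hJ => hI (FractionalIdeal.le_zero_iff.1 (hJ ▸ h))
    exact inv_anti_mono (inv_ne_zero_of_ne_zero hJ) (inv_ne_zero_of_ne_zero hI)
      (inv_anti_mono hI hJ h)

theorem divClosure_divClosure (I : FractionalIdeal R⁰ K) :
    divClosure (divClosure I) = divClosure I := by
  rcases eq_or_ne I 0 with rfl | hI
  · simp only [divClosure_zero]
  · have hI' : I⁻¹ ≠ 0 := inv_ne_zero_of_ne_zero hI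
    exact le_antisymm
      (inv_anti_mono hI' (inv_ne_zero_of_ne_zero (inv_ne_zero_of_ne_zero hI')) (le_divClosure I⁻¹))
      (le_divClosure _)

theorem divClosure_spanSingleton_mul (hc : c ≠ 0) (I : FractionalIdeal R⁰ K) :
    divClosure (spanSingleton R⁰ c * I) = spanSingleton R⁰ c * divClosure I := by
  rw [divClosure, spanSingleton_mul_inv_eq hc, spanSingleton_mul_inv_eq (inv_ne_zero hc), inv_inv,
    divClosure]

theorem StarOperation.star_le_divClosure (s : StarOperation R K) (I : FractionalIdeal R⁰ K) :
    s.star I ≤ divClosure I := by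
  rcases eq_or_ne I 0 with rfl | hI
  · have h_zero := s.smul_star 0 0
    simp only [spanSingleton_zero, zero_mul] at h_zero
    rw [← h_zero]
    exact FractionalIdeal.zero_le _
  · refine fun x hx => (mem_divClosure hI).2 fun z hz => ?_
    rw [← s.star_one]
    exact s.star_mono _ _ hz (s.smul_star z I ▸ mem_singleton_mul.2 ⟨x, hx, rfl⟩)

theorem StarOperation.star_eq_self_of_divClosure_eq (s : StarOperation R K)
    (hI : divClosure I = I) : s.star I = I :=
  le_antisymm ((s.star_le_divClosure I).trans hI.le) (s.le_star I)

end DivisorialClosure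

section LowerSets

variable {R K X : Type*} [CommRing R] [Field K] [Algebra R K] [IsFractionRing R K]
  [Preorder X] {rep : X → FractionalIdeal R⁰ K} {Δ : LowerSet X} {I J : FractionalIdeal R⁰ K}

/-- The ideals homothetic to a representative with index in `Δ`. -/
def IsClosedBy (rep : X → FractionalIdeal R⁰ K) (Δ : LowerSet X)
    (I : FractionalIdeal R⁰ K) : Prop :=
  ∃ x ∈ Δ, ∃ c : K, c ≠ 0 ∧ I = spanSingleton R⁰ c * rep x

theorem isClosedBy_spanSingleton_mul_iff {c : K} (hc : c ≠ 0) :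
    IsClosedBy rep Δ (spanSingleton R⁰ c * I) ↔ IsClosedBy rep Δ I := by
  have scale : ∀ {c : K} {I}, c ≠ 0 → IsClosedBy rep Δ I →
      IsClosedBy rep Δ (spanSingleton R⁰ c * I) := by
    rintro c I hc ⟨x, hx, d, hd, rfl⟩
    exact ⟨x, hx, c * d, mul_ne_zero hc hd, by
      rw [← mul_assoc, spanSingleton_mul_spanSingleton]⟩
  exact ⟨fun h => spanSingleton_inv_mul_cancel hc I ▸ scale (inv_ne_zero hc) h, scale hc⟩

variable [IsDomain R]

/-- The ideals `rep x` represent all nondivisorial classes up to homothety, each is covered by its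
divisorial closure, and the indices are ordered by divisibility: `x ≤ y` says that every star
operation closing `rep y` closes `rep x`, which here means that some multiple of `rep y`
contains `rep x` but not its divisorial closure. -/
structure IsNondivisorialTransversal (rep : X → FractionalIdeal R⁰ K) : Prop where
  divClosure_eq_or_exists : ∀ I : FractionalIdeal R⁰ K, divClosure I = I ∨
    ∃ x, ∃ c : K, c ≠ 0 ∧ I = spanSingleton R⁰ c * rep x
  covBy : ∀ x, rep x ⋖ divClosure (rep x)
  le_iff : ∀ x y, x ≤ y ↔ ∃ c : K, c ≠ 0 ∧ rep x ≤ spanSingleton R⁰ c * rep y ∧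
    ¬ divClosure (rep x) ≤ spanSingleton R⁰ c * rep y

namespace IsNondivisorialTransversal

theorem star_rep_eq_or_eq (h : IsNondivisorialTransversal rep) (s : StarOperation R K) (x : X) :
    s.star (rep x) = rep x ∨ s.star (rep x) = divClosure (rep x) :=
  (h.covBy x).eq_or_eq (s.le_star _) (s.star_le_divClosure _)

theorem star_rep_eq_of_le (h : IsNondivisorialTransversal rep) (s : StarOperation R K) {x y : X}
    (hxy : x ≤ y) (hy : s.star (rep y) = rep y) : s.star (rep x) = rep x := by
  obtain ⟨c, -, hle, hnle⟩ := (h.le_iff x y).1 hxy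
  refine (h.star_rep_eq_or_eq s x).resolve_right fun hx => hnle ?_
  have := s.star_mono _ _ hle
  rwa [← s.smul_star, hy, hx] at this

theorem star_ext (h : IsNondivisorialTransversal rep) {s s' : StarOperation R K}
    (hss' : ∀ x, s.star (rep x) = rep x ↔ s'.star (rep x) = rep x) : s = s' := by
  ext1
  funext I
  rcases h.divClosure_eq_or_exists I with hI | ⟨x, c, -, rfl⟩
  · rw [s.star_eq_self_of_divClosure_eq hI, s'.star_eq_self_of_divClosure_eq hI]
  · rw [← s.smul_star, ← s'.smul_star]
    by_cases hs : s.star (rep x) = rep x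
    · rw [hs, (hss' x).1 hs]
    · rw [(h.star_rep_eq_or_eq s x).resolve_left hs,
        (h.star_rep_eq_or_eq s' x).resolve_left (mt (hss' x).2 hs)]

theorem isClosedBy_of_le (h : IsNondivisorialTransversal rep) (hJ : IsClosedBy rep Δ J)
    (hIJ : I ≤ J) (hnle : ¬ divClosure I ≤ J) : IsClosedBy rep Δ I := by
  obtain ⟨y, hy, c, hc, rfl⟩ := hJ
  rcases h.divClosure_eq_or_exists I with hI | ⟨x, d, hd, rfl⟩
  · exact absurd (hI.le.trans hIJ) hnle
  · refine ⟨x, Δ.lower ((h.le_iff x y).2 ⟨d⁻¹ * c, mul_ne_zero (inv_ne_zero hd) hc, ?_⟩) hy,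
      d, hd, rfl⟩
    rw [← spanSingleton_mul_spanSingleton, mul_assoc, ← spanSingleton_mul_le_iff_le_inv_mul hd,
      ← spanSingleton_mul_le_iff_le_inv_mul hd, ← divClosure_spanSingleton_mul hd]
    exact ⟨hIJ, hnle⟩

theorem isClosedBy_rep_iff (h : IsNondivisorialTransversal rep) {x : X} :
    IsClosedBy rep Δ (rep x) ↔ x ∈ Δ := by
  constructor
  · rintro ⟨y, hy, c, hc, hxy⟩
    refine Δ.lower ((h.le_iff x y).2 ⟨c, hc, hxy.le, fun hle => ?_⟩) hy
    exact (h.covBy x).lt.not_ge (hle.trans hxy.ge)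
  · exact fun hx => ⟨x, hx, 1, one_ne_zero, by rw [spanSingleton_one, one_mul]⟩

open Classical in
/-- The star operation whose nondivisorial closed ideals are those given by a lower set. -/
noncomputable def starOfLowerSet (h : IsNondivisorialTransversal rep) (Δ : LowerSet X) :
    StarOperation R K where
  star I := if IsClosedBy rep Δ I then I else divClosure I
  le_star I := by
    split_ifs
    exacts [le_rfl, le_divClosure I]
  star_mono I J hIJ := by
    split_ifs with hI hJ hJ
    · exact hIJ
    · exact hIJ.trans (le_divClosure J)
    · exact not_not.1 fun hnle => hI (h.isClosedBy_of_le hJ hIJ hnle)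
    · exact divClosure_mono hIJ
  star_star I := by
    by_cases hI : IsClosedBy rep Δ I
    · simp only [hI, if_true]
    · simp only [hI, if_false, divClosure_divClosure, ite_self]
  smul_star c I := by
    rcases eq_or_ne c 0 with rfl | hc
    · simp only [spanSingleton_zero, zero_mul, divClosure_zero, ite_self]
    · simp only [isClosedBy_spanSingleton_mul_iff hc, divClosure_spanSingleton_mul hc, mul_ite]
  star_one := by simp only [divClosure_one, ite_self]

theorem starOfLowerSet_star_rep_eq_iff (h : IsNondivisorialTransversal rep) (Δ : LowerSet X)
    (x : X) : (h.starOfLowerSet Δ).star (rep x) = rep x ↔ x ∈ Δ := by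
  simp only [starOfLowerSet, h.isClosedBy_rep_iff, ite_eq_left_iff, (h.covBy x).ne', imp_false,
    not_not]

/-- A star operation is determined by the representatives it closes. -/
noncomputable def starOperationEquiv (h : IsNondivisorialTransversal rep) :
    StarOperation R K ≃ LowerSet X where
  toFun s := ⟨{x | s.star (rep x) = rep x}, fun _ _ hxy => h.star_rep_eq_of_le s hxy⟩
  invFun := h.starOfLowerSet
  left_inv _ := h.star_ext fun x => h.starOfLowerSet_star_rep_eq_iff _ x
  right_inv Δ := LowerSet.ext (Set.ext fun x => h.starOfLowerSet_star_rep_eq_iff Δ x)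

end IsNondivisorialTransversal

end LowerSets

/-- The homothety classes of nondivisorial ideals, where the classes of planes are indexed by `Y`.
The order `x ≤ y` means that every star operation closing the ideals of `y` closes those of `x`.
-/
inductive NondivisorialClass (Y : Type*)
  | least
  | plane (y : Y)
  | hyperplane
  | canonical

namespace NondivisorialClass

variable {Y : Type*}

/-- The height of a class in the poset of classes. -/
def height : NondivisorialClass Y → ℕ
  | least => 0
  | plane _ => 1
  | hyperplane => 2
  | canonical => 3

/-- The missing value `≥ 3` of the ideals of a class that have least value `0`. -/
def gap : NondivisorialClass Y → ℤ
  | canonical => 6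
  | _ => 3

theorem gap_eq_three {x : NondivisorialClass Y} (hx : x ≠ canonical) : x.gap = 3 := by
  cases x <;> first | rfl | exact absurd rfl hx

instance : Preorder (NondivisorialClass Y) where
  le x y := x = y ∨ x.height < y.height
  le_refl _ := .inl rfl
  le_trans := by
    rintro x y z (rfl | hxy) (rfl | hyz)
    exacts [.inl rfl, .inr hyz, .inr hxy, .inr (hxy.trans hyz)]

theorem le_iff {x y : NondivisorialClass Y} : x ≤ y ↔ x = y ∨ x.height < y.height := Iff.rfl

theorem least_le (x : NondivisorialClass Y) : least ≤ x := by
  rcases x with - | y | - | - <;> simp [le_iff, height]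

theorem plane_le_hyperplane (y : Y) : plane y ≤ hyperplane := .inr (by simp [height])

theorem lt_canonical_iff {x : NondivisorialClass Y} : x < canonical ↔ x ≠ canonical := by
  rcases x with - | y | - | - <;> simp [lt_iff_le_not_ge, le_iff, height]

/-- The nonempty lower set without `hyperplane` that has a given set of planes. -/
def lowerSetOfPlanes (s : Set Y) : LowerSet (NondivisorialClass Y) where
  carrier := {x | x = least ∨ ∃ y ∈ s, x = plane y}
  lower' := by
    rintro _ x hx (rfl | ⟨y, hy, rfl⟩) <;> rcases x with - | y | - | - <;>
      simp_all [le_iff, height]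

theorem mem_lowerSetOfPlanes {s : Set Y} {x : NondivisorialClass Y} :
    x ∈ lowerSetOfPlanes s ↔ x = least ∨ ∃ y ∈ s, x = plane y := Iff.rfl

theorem lowerSetOfPlanes_injective :
    Function.Injective (lowerSetOfPlanes : Set Y → LowerSet (NondivisorialClass Y)) := by
  intro s s' h
  ext y
  simpa [mem_lowerSetOfPlanes] using SetLike.ext_iff.1 h (plane y)

theorem eq_of_lowerSet (Δ : LowerSet (NondivisorialClass Y)) :
    Δ = ⊥ ∨ (∃ s, Δ = lowerSetOfPlanes s) ∨ Δ = LowerSet.Iio canonical ∨ Δ = ⊤ := by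
  by_cases hcan : canonical ∈ Δ
  · refine .inr (.inr (.inr (eq_top_iff.2 fun x _ => ?_)))
    rcases eq_or_ne x canonical with rfl | hx
    exacts [hcan, Δ.lower (lt_canonical_iff.2 hx).le hcan]
  by_cases hhyp : hyperplane ∈ Δ
  · have hleast : least ∈ Δ := Δ.lower (least_le _) hhyp
    have hplane y : plane y ∈ Δ := Δ.lower (plane_le_hyperplane y) hhyp
    refine .inr (.inr (.inl (SetLike.ext fun x => ?_)))
    rcases x with - | y | - | - <;> simp [lt_canonical_iff, hleast, hplane, hhyp, hcan]
  by_cases hleast : least ∈ Δ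
  · refine .inr (.inl ⟨{y | plane y ∈ Δ}, SetLike.ext fun x => ?_⟩)
    rcases x with - | y | - | - <;> simp [mem_lowerSetOfPlanes, hleast, hhyp, hcan]
  · exact .inl (eq_bot_iff.2 fun x hx => hleast (Δ.lower (least_le x) hx))

theorem nonempty_lowerSet_equiv :
    Nonempty (LowerSet (NondivisorialClass Y) ≃ Set Y ⊕ Fin 3) := by
  have hlt : (⊥ : LowerSet (NondivisorialClass Y)) < LowerSet.Iio canonical :=
    bot_lt_iff_ne_bot.2 fun h => by
      have : (least : NondivisorialClass Y) ∈ LowerSet.Iio canonical := by simp [lt_canonical_iff]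
      simp [h] at this
  have hlt' : LowerSet.Iio (canonical : NondivisorialClass Y) < ⊤ :=
    lt_top_iff_ne_top.2 fun h => by
      have : (canonical : NondivisorialClass Y) ∉ LowerSet.Iio canonical := by simp
      simp [h] at this
  refine ⟨(Equiv.ofBijective (Sum.elim lowerSetOfPlanes ![⊥, LowerSet.Iio canonical, ⊤])
    ⟨lowerSetOfPlanes_injective.sumElim ?_ ?_, ?_⟩).symm⟩
  · refine (Fin.strictMono_iff_lt_succ.2 fun i => ?_).injective
    fin_cases i
    exacts [hlt, hlt']
  · intro s i h
    have hleast : least ∈ lowerSetOfPlanes s := .inl rfl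
    have hhyp : hyperplane ∉ lowerSetOfPlanes s := by simp [mem_lowerSetOfPlanes]
    rw [h] at hleast hhyp
    fin_cases i <;> simp [lt_canonical_iff] at hleast hhyp
  · intro Δ
    rcases eq_of_lowerSet Δ with rfl | ⟨s, rfl⟩ | rfl | rfl
    exacts [⟨.inr 0, rfl⟩, ⟨.inl s, rfl⟩, ⟨.inr 1, rfl⟩, ⟨.inr 2, rfl⟩]

end NondivisorialClass

open WithZero

section HasOrder

variable {K : Type*} [Field K] {v : Valuation K ℤᵐ⁰} {x y t : K} {m n : ℤ}

/-- `x` has order `n` in additive notation: Mathlib's discrete valuations are multiplicative, so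
that large orders correspond to small values. -/
def HasOrder (v : Valuation K ℤᵐ⁰) (x : K) (n : ℤ) : Prop := v x = exp (-n)

theorem hasOrder_one : HasOrder v 1 0 := by rw [HasOrder, map_one, neg_zero, exp_zero]

theorem exists_hasOrder_of_ne_zero (v : Valuation K ℤᵐ⁰) (hx : x ≠ 0) : ∃ n, HasOrder v x n :=
  ⟨-log (v x), by rw [HasOrder, neg_neg, exp_log (v.ne_zero_iff.2 hx)]⟩

namespace HasOrder

theorem ne_zero (hx : HasOrder v x n) : x ≠ 0 :=
  v.ne_zero_iff.1 (hx.symm ▸ exp_ne_zero)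

theorem unique (hm : HasOrder v x m) (hn : HasOrder v x n) : m = n :=
  neg_injective (exp_injective (hm.symm.trans hn))

theorem mul (hx : HasOrder v x m) (hy : HasOrder v y n) : HasOrder v (x * y) (m + n) := by
  rw [HasOrder, map_mul, hx, hy, ← exp_add, neg_add]

theorem inv (hx : HasOrder v x n) : HasOrder v x⁻¹ (-n) := by
  rw [HasOrder, map_inv₀, hx, ← exp_neg]

theorem zpow (ht : HasOrder v t 1) (n : ℤ) : HasOrder v (t ^ n) n := by
  rw [HasOrder, map_zpow₀, ht, ← exp_zsmul, smul_neg, smul_eq_mul, mul_one]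

theorem pow (ht : HasOrder v t 1) (n : ℕ) : HasOrder v (t ^ n) n := by
  exact_mod_cast ht.zpow n

theorem lt_iff (hx : HasOrder v x n) : v y < v x ↔ v y ≤ exp (-(n + 1)) := by
  rw [hx]
  rcases eq_or_ne y 0 with rfl | hy
  · simp only [map_zero, exp_pos, zero_le]
  · obtain ⟨k, hk⟩ := exists_hasOrder_of_ne_zero v hy
    rw [hk, exp_lt_exp, exp_le_exp]
    lia

end HasOrder

end HasOrder

section ValueSet

variable {R K : Type*} [CommRing R] [Field K] [Algebra R K] {v : Valuation K ℤᵐ⁰}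
  {I J : FractionalIdeal R⁰ K} {u x : K} {m n : ℤ}

/-- The set of orders of the nonzero elements of a fractional ideal. -/
def valueSet (v : Valuation K ℤᵐ⁰) (I : FractionalIdeal R⁰ K) : Set ℤ :=
  {n | ∃ x ∈ I, HasOrder v x n}

theorem HasOrder.mem_valueSet (hx : HasOrder v x n) (hxI : x ∈ I) : n ∈ valueSet v I :=
  ⟨x, hxI, hx⟩

theorem valueSet_mono (h : I ≤ J) : valueSet v I ⊆ valueSet v J :=
  fun _ ⟨x, hx, hxn⟩ => ⟨x, h hx, hxn⟩

theorem ne_zero_of_mem_valueSet (hn : n ∈ valueSet v I) : I ≠ 0 := by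
  rintro rfl
  obtain ⟨x, hx, hxn⟩ := hn
  exact hxn.ne_zero ((mem_zero_iff _).1 hx)

theorem nonempty_valueSet (v : Valuation K ℤᵐ⁰) (hI : I ≠ 0) : (valueSet v I).Nonempty := by
  obtain ⟨x, hxI, hx⟩ : ∃ x ∈ I, x ≠ 0 := by
    by_contra! h
    exact hI (eq_zero_iff.2 h)
  obtain ⟨n, hn⟩ := exists_hasOrder_of_ne_zero v hx
  exact ⟨n, hn.mem_valueSet hxI⟩

theorem add_mem_valueSet_spanSingleton_mul [IsFractionRing R K] (hx : HasOrder v x m)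
    (hn : n ∈ valueSet v I) : m + n ∈ valueSet v (spanSingleton R⁰ x * I) :=
  let ⟨y, hyI, hy⟩ := hn
  (hx.mul hy).mem_valueSet (mem_singleton_mul.2 ⟨y, hyI, rfl⟩)

theorem valueSet_spanSingleton_mul [IsFractionRing R K] (hx : HasOrder v x m) :
    n ∈ valueSet v (spanSingleton R⁰ x * I) ↔ n - m ∈ valueSet v I := by
  constructor
  · intro h
    have := add_mem_valueSet_spanSingleton_mul hx.inv h
    rwa [spanSingleton_inv_mul_cancel hx.ne_zero, neg_add_eq_sub] at this
  · intro h
    simpa only [add_sub_cancel] using add_mem_valueSet_spanSingleton_mul hx h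

theorem valueSet_subset_of_spanSingleton_mul_le [IsFractionRing R K] (hu : HasOrder v u 0)
    (h : spanSingleton R⁰ u * I ≤ J) : valueSet v I ⊆ valueSet v J := by
  intro n hn
  simpa only [zero_add] using valueSet_mono h (add_mem_valueSet_spanSingleton_mul hu hn)

end ValueSet

section ResiduallyRational

/-- The valuation `v` is normalized, nonnegative on `R`, its residue field is not larger than the
one of `R`, and `R` has a nonzero conductor in the valuation ring. The third condition is stated
for quotients: some `r : R` approximates `y / x`. -/
class IsResiduallyRational (R : Type*) {K : Type*} [CommRing R] [Field K] [Algebra R K]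
    (v : Valuation K ℤᵐ⁰) : Prop where
  exists_hasOrder_one (R v) : ∃ t, HasOrder v t 1
  map_algebraMap_le_one (v) (r : R) : v (algebraMap R K r) ≤ 1
  exists_map_sub_lt : ∀ x y, x ≠ 0 → v y ≤ v x → ∃ r : R, v (y - algebraMap R K r * x) < v x
  exists_conductor (R v) : ∃ n : ℤ, ∀ x, v x ≤ exp (-n) → ∃ r : R, algebraMap R K r = x

variable {R K : Type*} [CommRing R] [IsDomain R] [Field K] [Algebra R K]
  {v : Valuation K ℤᵐ⁰} [IsResiduallyRational R v] {I J : FractionalIdeal R⁰ K} {x y u w : K}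
  {k m n g : ℤ}

theorem exists_hasOrder (R : Type*) {K : Type*} [CommRing R] [Field K] [Algebra R K]
    (v : Valuation K ℤᵐ⁰) [IsResiduallyRational R v] (n : ℤ) : ∃ x, HasOrder v x n :=
  let ⟨t, ht⟩ := IsResiduallyRational.exists_hasOrder_one R v
  ⟨t ^ n, ht.zpow n⟩

variable (R v) in
/-- The fractional ideal of the elements of order at least `n`. -/
def valIdeal (n : ℤ) : FractionalIdeal R⁰ K :=
  ⟨{ carrier := {x | v x ≤ exp (-n)}
     add_mem' := v.map_add_le
     zero_mem' := by simp only [Set.mem_ofPred_eq, map_zero, zero_le]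
     smul_mem' := fun r x hx => by
      rw [Set.mem_ofPred_eq, Algebra.smul_def, map_mul]
      exact mul_le_of_le_one_of_le
        (IsResiduallyRational.map_algebraMap_le_one v r) hx }, by
    obtain ⟨c, hc⟩ := IsResiduallyRational.exists_conductor R v
    obtain ⟨z, hz⟩ := exists_hasOrder R v (max c (c - n))
    obtain ⟨d, rfl⟩ := hc z (hz.le.trans (exp_le_exp.2 (by lia)))
    have hd : d ≠ 0 := fun hd => hz.ne_zero (by rw [hd, map_zero])
    refine ⟨d, mem_nonZeroDivisors_of_ne_zero hd, fun x hx => hc _ ?_⟩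
    calc v (d • x) = exp (-max c (c - n)) * v x := by rw [Algebra.smul_def, map_mul, hz]
      _ ≤ exp (-max c (c - n)) * exp (-n) := mul_le_mul_right hx _
      _ ≤ exp (-c) := by rw [← exp_add, exp_le_exp]; lia⟩

theorem mem_valIdeal : x ∈ valIdeal R v n ↔ v x ≤ exp (-n) := Iff.rfl

theorem mul_mem_valIdeal (hx : x ∈ valIdeal R v m) (hy : y ∈ valIdeal R v n) :
    x * y ∈ valIdeal R v (m + n) := by
  rw [mem_valIdeal, map_mul, neg_add, exp_add]
  exact mul_le_mul' hx hy

theorem HasOrder.mem_valIdeal_iff (hx : HasOrder v x m) : x ∈ valIdeal R v n ↔ n ≤ m := by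
  rw [mem_valIdeal, hx, exp_le_exp, neg_le_neg_iff]

theorem HasOrder.mem_valIdeal (hx : HasOrder v x n) : x ∈ valIdeal R v n := hx.le

theorem valIdeal_anti (h : m ≤ n) : valIdeal R v n ≤ valIdeal R v m :=
  fun _ hx => hx.trans (exp_le_exp.2 (neg_le_neg h))

theorem hasOrder_of_mem_of_notMem (hx : x ∈ valIdeal R v n) (hx' : x ∉ valIdeal R v (n + 1)) :
    HasOrder v x n := by
  have hx0 : x ≠ 0 := fun h => hx' (h ▸ zero_mem _)
  obtain ⟨k, hk⟩ := exists_hasOrder_of_ne_zero v hx0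
  rw [hk.mem_valIdeal_iff] at hx hx'
  rwa [show n = k by lia]

theorem HasOrder.add_of_mem (hx : HasOrder v x n) (hy : y ∈ valIdeal R v (n + 1)) :
    HasOrder v (x + y) n := by
  rw [HasOrder, v.map_add_eq_of_lt_left (hx.lt_iff.2 hy), hx]

theorem HasOrder.sub_of_mem (hx : HasOrder v x n) (hy : y ∈ valIdeal R v (n + 1)) :
    HasOrder v (x - y) n :=
  sub_eq_add_neg x y ▸ hx.add_of_mem (neg_mem hy)

theorem HasOrder.exists_sub_mem (hx : HasOrder v x n) (hy : y ∈ valIdeal R v n) :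
    ∃ r : R, y - algebraMap R K r * x ∈ valIdeal R v (n + 1) := by
  obtain ⟨r, hr⟩ := IsResiduallyRational.exists_map_sub_lt (R := R) x y hx.ne_zero (hy.trans hx.ge)
  exact ⟨r, hx.lt_iff.1 hr⟩

theorem algebraMap_mem_valIdeal_zero (r : R) : algebraMap R K r ∈ valIdeal R v 0 :=
  (IsResiduallyRational.map_algebraMap_le_one v r).trans_eq (by rw [neg_zero, exp_zero])

theorem exists_le_valIdeal [IsFractionRing R K] (v : Valuation K ℤᵐ⁰) [IsResiduallyRational R v]
    (I : FractionalIdeal R⁰ K) : ∃ m, I ≤ valIdeal R v m := by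
  obtain ⟨d, hd, hdI⟩ := I.isFractional
  have hd0 : algebraMap R K d ≠ 0 := IsFractionRing.to_map_ne_zero_of_mem_nonZeroDivisors hd
  obtain ⟨k, hk⟩ := exists_hasOrder_of_ne_zero v hd0
  refine ⟨-k, fun x hx => ?_⟩
  obtain ⟨r, hr⟩ := hdI x hx
  have := mul_mem_valIdeal hk.inv.mem_valIdeal (algebraMap_mem_valIdeal_zero (v := v) r)
  rwa [hr, Algebra.smul_def, inv_mul_cancel_left₀ hd0, add_zero] at this

theorem HasOrder.valIdeal_le (hx : HasOrder v x n) (hxI : x ∈ I) :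
    ∃ m, valIdeal R v m ≤ I := by
  obtain ⟨c, hc⟩ := IsResiduallyRational.exists_conductor R v
  refine ⟨c + n, fun y hy => ?_⟩
  obtain ⟨r, hr⟩ := hc (y * x⁻¹) <| by
    rw [← add_neg_cancel_right c n]
    exact mul_mem_valIdeal hy hx.inv.mem_valIdeal
  have := algebraMap_mul_mem r hxI
  rwa [hr, inv_mul_cancel_right₀ hx.ne_zero] at this

theorem valueSet_valIdeal (n : ℤ) : valueSet v (valIdeal R v n) = Set.Ici n := by
  ext m
  constructor
  · rintro ⟨x, hx, hxm⟩
    exact hxm.mem_valIdeal_iff.1 hx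
  · intro hm
    obtain ⟨x, hx⟩ := exists_hasOrder R v m
    exact hx.mem_valueSet (hx.mem_valIdeal_iff.2 hm)

theorem le_valIdeal_iff : I ≤ valIdeal R v n ↔ valueSet v I ⊆ Set.Ici n := by
  constructor
  · exact fun h => (valueSet_mono h).trans (valueSet_valIdeal n).subset
  · intro h x hx
    rcases eq_or_ne x 0 with rfl | hx0
    · exact zero_mem _
    · obtain ⟨k, hk⟩ := exists_hasOrder_of_ne_zero v hx0
      exact hk.mem_valIdeal_iff.2 (h (hk.mem_valueSet hx))

/-- Successive approximation: an element of `J` is corrected by elements of `I` of the same order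
until it lies in the conductor. -/
theorem eq_of_le_of_valueSet_subset (hIJ : I ≤ J) (h : valueSet v J ⊆ valueSet v I) : I = J := by
  rcases eq_or_ne J 0 with rfl | hJ
  · exact le_antisymm hIJ (FractionalIdeal.zero_le I)
  obtain ⟨k, y, hyJ, hyk⟩ := nonempty_valueSet v hJ
  obtain ⟨x, hxI, hxk⟩ := h (hyk.mem_valueSet hyJ)
  obtain ⟨c, hc⟩ := hxk.valIdeal_le hxI
  have descent (j : ℕ) : ∀ y ∈ J, y ∈ valIdeal R v (c - j) → y ∈ I := by
    induction j with
    | zero => exact fun y _ hy => hc (by simpa only [Nat.cast_zero, sub_zero] using hy)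
    | succ j ih =>
      intro y hyJ hy
      rw [show c - (j : ℤ) = c - (j + 1 : ℕ) + 1 by lia] at ih
      by_cases hy' : y ∈ valIdeal R v (c - (j + 1 : ℕ) + 1)
      · exact ih y hyJ hy'
      obtain ⟨x, hxI, hx⟩ := h ((hasOrder_of_mem_of_notMem hy hy').mem_valueSet hyJ)
      obtain ⟨r, hr⟩ := hx.exists_sub_mem hy
      have hrx : algebraMap R K r * x ∈ I := algebraMap_mul_mem r hxI
      rw [← sub_add_cancel y]
      exact add_mem (ih _ (sub_mem hyJ (hIJ hrx)) hr) hrx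
  refine le_antisymm hIJ fun y hyJ => ?_
  rcases eq_or_ne y 0 with rfl | hy0
  · exact zero_mem I
  · obtain ⟨n, hn⟩ := exists_hasOrder_of_ne_zero v hy0
    exact descent (c - n).toNat y hyJ (hn.mem_valIdeal_iff.2 (by lia))

theorem valIdeal_le_iff : valIdeal R v n ≤ I ↔ Set.Ici n ⊆ valueSet v I := by
  constructor
  · exact fun h => (valueSet_valIdeal n).superset.trans (valueSet_mono h)
  · intro h
    refine inf_eq_left.1 (eq_of_le_of_valueSet_subset (v := v) inf_le_left ?_)
    rw [valueSet_valIdeal]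
    intro m hm
    obtain ⟨x, hxI, hx⟩ := h hm
    exact hx.mem_valueSet ⟨hx.mem_valIdeal_iff.2 hm, hxI⟩

theorem valIdeal_le_of_Ici_subset_insert (h : Set.Ici n ⊆ insert g (valueSet v I)) (hn : n ≤ m)
    (hg : g < m) : valIdeal R v m ≤ I :=
  valIdeal_le_iff.2 fun _ hj =>
    (h (hn.trans hj)).resolve_left (hg.trans_le hj).ne'

theorem valueSet_sup_valIdeal (I : FractionalIdeal R⁰ K) (n : ℤ) :
    valueSet v (I ⊔ valIdeal R v n) = valueSet v I ∪ Set.Ici n := by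
  refine subset_antisymm ?_ (Set.union_subset (valueSet_mono le_sup_left)
    ((valueSet_valIdeal n).superset.trans (valueSet_mono le_sup_right)))
  rintro m ⟨z, hz, hzm⟩
  rw [sup_eq_add, mem_add] at hz
  obtain ⟨x, hxI, y, hy, rfl⟩ := hz
  refine or_iff_not_imp_right.2 fun hm => ?_
  rw [Set.mem_Ici, not_le] at hm
  have := hzm.sub_of_mem (valIdeal_anti hm hy)
  rw [add_sub_cancel_right] at this
  exact this.mem_valueSet hxI

variable [IsFractionRing R K]

theorem valueSet_spanSingleton_sup (hx : HasOrder v x n) (hn : n ∉ valueSet v I)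
    (hmul : ∀ r : R, algebraMap R K r ∈ valIdeal R v 1 → algebraMap R K r * x ∈ I) :
    valueSet v (spanSingleton R⁰ x ⊔ I) = insert n (valueSet v I) := by
  refine subset_antisymm ?_ (Set.insert_subset
    (hx.mem_valueSet (le_sup_left (b := I) (mem_spanSingleton_self R⁰ x)))
    (valueSet_mono le_sup_right))
  rintro m ⟨z, hz, hzm⟩
  rw [sup_eq_add, mem_add] at hz
  obtain ⟨z, hz, y, hyI, rfl⟩ := hz
  obtain ⟨r, rfl⟩ := mem_spanSingleton R⁰ |>.1 hz
  rw [Algebra.smul_def] at hzm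
  by_cases hr : algebraMap R K r ∈ valIdeal R v (0 + 1)
  · exact .inr (hzm.mem_valueSet (add_mem (hmul r hr) hyI))
  have hrx : HasOrder v (algebraMap R K r * x) n := by
    simpa only [zero_add] using
      (hasOrder_of_mem_of_notMem (algebraMap_mem_valIdeal_zero r) hr).mul hx
  rcases lt_trichotomy m n with hmn | rfl | hmn
  · have hy := hzm.sub_of_mem (hrx.mem_valIdeal_iff (R := R).2 hmn)
    rw [add_sub_cancel_left] at hy
    exact .inr (hy.mem_valueSet hyI)
  · exact .inl rfl
  · have hy := hrx.sub_of_mem (hzm.mem_valIdeal_iff (R := R).2 hmn)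
    rw [sub_add_cancel_left] at hy
    exact absurd (hy.mem_valueSet (neg_mem hyI)) hn

theorem eq_spanSingleton_mul_of_le (hu : HasOrder v u 0) (hle : spanSingleton R⁰ u * I ≤ J)
    (h : valueSet v J ⊆ valueSet v I) : J = spanSingleton R⁰ u * I :=
  (eq_of_le_of_valueSet_subset hle fun _ hn =>
    (valueSet_spanSingleton_mul hu).2 (by simpa only [sub_zero] using h hn)).symm

theorem exists_sub_mul_mem (hw : HasOrder v w m) (h : Set.Ici n ⊆ insert m (valueSet v I))
    (hy : y ∈ valIdeal R v n) : ∃ r : R, y - algebraMap R K r * w ∈ I := by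
  have hle : valIdeal R v n ≤ spanSingleton R⁰ w ⊔ I := valIdeal_le_iff.2 <| h.trans <|
    Set.insert_subset (hw.mem_valueSet (le_sup_left (b := I) (mem_spanSingleton_self R⁰ w)))
      (valueSet_mono le_sup_right)
  have hy := hle hy
  rw [sup_eq_add, mem_add] at hy
  obtain ⟨z, hz, x, hxI, rfl⟩ := hy
  obtain ⟨r, rfl⟩ := mem_spanSingleton R⁰ |>.1 hz
  exact ⟨r, by rwa [Algebra.smul_def, add_sub_cancel_left]⟩

theorem exists_hasOrder_mul_mem_of_succ (hI : I ≤ valIdeal R v 0)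
    (hJ : Set.Ici n ⊆ insert g (valueSet v J)) (hk : n + k < g) (hu : HasOrder v u n)
    (huI : ∀ x ∈ I, x ∈ valIdeal R v (k + 1) → u * x ∈ J) :
    ∃ u', HasOrder v u' n ∧ ∀ x ∈ I, x ∈ valIdeal R v k → u' * x ∈ J := by
  by_cases hkI : k ∈ valueSet v I
  swap
  · refine ⟨u, hu, fun x hxI hx => huI x hxI ?_⟩
    exact by_contra fun hx' => hkI ((hasOrder_of_mem_of_notMem hx hx').mem_valueSet hxI)
  have hk0 : 0 ≤ k := le_valIdeal_iff.1 hI hkI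
  have hgJ : valIdeal R v (g + 1) ≤ J :=
    valIdeal_le_of_Ici_subset_insert hJ (by lia) (lt_add_one g)
  obtain ⟨y, hyI, hy⟩ := hkI
  obtain ⟨p, hp⟩ := exists_hasOrder R v (g - k)
  obtain ⟨r, hr⟩ := exists_sub_mul_mem (R := R) (y := u * y) (n := n) (by simpa using hp.mul hy) hJ
    ((hu.mul hy).mem_valIdeal_iff.2 (by lia))
  have hrp : algebraMap R K r * p ∈ valIdeal R v (g - k) := algebraMap_mul_mem r hp.mem_valIdeal
  refine ⟨u - algebraMap R K r * p, hu.sub_of_mem (valIdeal_anti (by lia) hrp), fun x hxI hx => ?_⟩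
  obtain ⟨s, hs⟩ := hy.exists_sub_mem hx
  have hrp_mul : algebraMap R K r * p * (x - algebraMap R K s * y) ∈ J :=
    hgJ (valIdeal_anti (by lia) (mul_mem_valIdeal hrp hs))
  have hu_mul : u * (x - algebraMap R K s * y) ∈ J :=
    huI _ (sub_mem hxI (algebraMap_mul_mem s hyI)) hs
  convert add_mem (sub_mem hu_mul hrp_mul) (algebraMap_mul_mem s hr) using 1
  ring

/-- Duality: if all orders `≥ n` other than `g` occur in `J` and `g - n` does not occur in `I`, then
some multiple of `I` by an element of order `n` lies in `J`. The multiplier is corrected once for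
every order `k < g - n` of `I`, to kill the component of order `g` of its product with an element
of order `k`. -/
theorem exists_hasOrder_spanSingleton_mul_le (hI : I ≤ valIdeal R v 0)
    (hJ : Set.Ici n ⊆ insert g (valueSet v J)) (hg : g - n ∉ valueSet v I) :
    ∃ u, HasOrder v u n ∧ spanSingleton R⁰ u * I ≤ J := by
  have descent (j : ℕ) : ∃ u, HasOrder v u n ∧
      ∀ x ∈ I, x ∈ valIdeal R v (g - n - j) → u * x ∈ J := by
    induction j with
    | zero =>
      obtain ⟨u, hu⟩ := exists_hasOrder R v n
      refine ⟨u, hu, fun x hxI hx => ?_⟩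
      rcases eq_or_ne x 0 with rfl | hx0
      · simpa only [mul_zero] using zero_mem J
      obtain ⟨k, hk⟩ := exists_hasOrder_of_ne_zero v hx0
      have hkI : k ∈ valueSet v I := hk.mem_valueSet hxI
      have hk0 : 0 ≤ k := le_valIdeal_iff.1 hI hkI
      have hkn : g - n - (0 : ℕ) ≤ k := hk.mem_valIdeal_iff.1 hx
      have hne : k ≠ g - n := fun h => hg (h ▸ hkI)
      exact valIdeal_le_of_Ici_subset_insert hJ (m := n + k) (by lia) (by lia)
        (hu.mul hk).mem_valIdeal
    | succ j ih =>
      obtain ⟨u, hu, huI⟩ := ih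
      refine exists_hasOrder_mul_mem_of_succ hI hJ (by lia) hu ?_
      convert huI using 4
      lia
  obtain ⟨u, hu, huI⟩ := descent (g - n).toNat
  exact ⟨u, hu, spanSingleton_mul_le_iff.2 fun x hx =>
    huI x hx (valIdeal_anti (by lia) (hI hx))⟩

end ResiduallyRational

section Gap

/-- The value semigroup of `R` is `⟨4, 5, 7⟩ = {0, 4, 5} ∪ [7, ∞)`. -/
class HasValuesFourFiveSeven (R : Type*) {K : Type*} [CommRing R] [Field K] [Algebra R K]
    (v : Valuation K ℤᵐ⁰) : Prop extends IsResiduallyRational R v where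
  mem_valueSet_one_iff (n : ℤ) :
    n ∈ valueSet v (1 : FractionalIdeal R⁰ K) ↔ n = 0 ∨ n = 4 ∨ n = 5 ∨ 7 ≤ n

open HasValuesFourFiveSeven

/-- The value sets of the nondivisorial ideals normalized to have least value `0`: the only value
`≥ 3` that is missing is `g`. -/
structure IsNormalizedWithGap (S : Set ℤ) (g : ℤ) : Prop where
  subset_Ici : S ⊆ Set.Ici 0
  zero_mem : 0 ∈ S
  gap_notMem : g ∉ S
  Ici_subset : Set.Ici 3 ⊆ insert g S
  three_le_gap : 3 ≤ g

variable {R K : Type*} [CommRing R] [Field K] [Algebra R K]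
  {v : Valuation K ℤᵐ⁰} [HasValuesFourFiveSeven R v] {I J : FractionalIdeal R⁰ K}
  {m n g h : ℤ}

theorem add_mem_valueSet (hm : m ∈ valueSet v I) (hn : n = 0 ∨ n = 4 ∨ n = 5 ∨ 7 ≤ n) :
    n + m ∈ valueSet v I := by
  obtain ⟨_, hr, hrn⟩ := (mem_valueSet_one_iff (R := R) (v := v) n).2 hn
  obtain ⟨r, rfl⟩ := (mem_one_iff _).1 hr
  obtain ⟨x, hxI, hx⟩ := hm
  exact (hrn.mul hx).mem_valueSet (algebraMap_mul_mem r hxI)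

theorem IsNormalizedWithGap.gap_eq (hI : IsNormalizedWithGap (valueSet v I) g) :
    g = 3 ∨ g = 6 := by
  refine or_iff_not_imp_left.2 fun hg3 => ?_
  have h3 : 3 ∈ valueSet v I := (hI.Ici_subset Set.self_mem_Ici).resolve_left (Ne.symm hg3)
  have not_add {m n : ℤ} (hm : m ∈ valueSet v I) (hg : g = n + m) :
      ¬ (n = 0 ∨ n = 4 ∨ n = 5 ∨ 7 ≤ n) :=
    fun hn => hI.gap_notMem (hg ▸ add_mem_valueSet hm hn)
  have h0 := not_add hI.zero_mem (n := g) (add_zero g).symm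
  have h3 := not_add h3 (n := g - 3) (sub_add_cancel g 3).symm
  have hg := hI.three_le_gap
  lia

variable [IsDomain R]

theorem valIdeal_seven_le_one : valIdeal R v 7 ≤ 1 :=
  valIdeal_le_iff.2 fun n hn => (mem_valueSet_one_iff n).2 (.inr (.inr (.inr hn)))

theorem algebraMap_mem_valIdeal_four {r : R} (hr : algebraMap R K r ∈ valIdeal R v 1) :
    algebraMap R K r ∈ valIdeal R v 4 := by
  by_cases h0 : algebraMap R K r = 0
  · exact h0 ▸ zero_mem _
  obtain ⟨n, hn⟩ := exists_hasOrder_of_ne_zero v h0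
  have hn1 : 1 ≤ n := hn.mem_valIdeal_iff.1 hr
  have hnS := (mem_valueSet_one_iff n).1 (hn.mem_valueSet (coe_mem_one R⁰ r))
  exact hn.mem_valIdeal_iff.2 (by lia)

theorem IsNormalizedWithGap.valIdeal_four_le (hI : IsNormalizedWithGap (valueSet v I) 3) :
    valIdeal R v 4 ≤ I :=
  valIdeal_le_of_Ici_subset_insert hI.Ici_subset (by lia) (by lia)

variable [IsFractionRing R K]

theorem divClosure_eq_self_of_Ici_subset (hI : I ≤ valIdeal R v 0) (h0 : 0 ∈ valueSet v I)
    (h3 : Set.Ici 3 ⊆ valueSet v I) : divClosure I = I := by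
  refine (eq_of_le_of_valueSet_subset (v := v) (le_divClosure I) ?_).symm
  rintro n ⟨x, hx, hxn⟩
  by_contra hn
  have hn3 : ¬ 3 ≤ n := fun h => hn (h3 h)
  have h6 : Set.Ici (6 - n) ⊆ insert 6 (valueSet v (1 : FractionalIdeal R⁰ K)) := by
    intro k hk
    rw [Set.mem_Ici] at hk
    rw [Set.mem_insert_iff, mem_valueSet_one_iff]
    lia
  obtain ⟨z, hz, hzI⟩ := exists_hasOrder_spanSingleton_mul_le hI h6 (by rwa [sub_sub_cancel])
  have hzx := (hz.mul hxn).mem_valueSet ((mem_divClosure (ne_zero_of_mem_valueSet h0)).1 hx z hzI)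
  rw [mem_valueSet_one_iff] at hzx
  lia

namespace IsNormalizedWithGap

theorem valIdeal_three_le_divClosure (hI : IsNormalizedWithGap (valueSet v I) g) :
    valIdeal R v 3 ≤ divClosure I := by
  intro x hx
  refine (mem_divClosure (ne_zero_of_mem_valueSet hI.zero_mem)).2 fun z hz => ?_
  rcases eq_or_ne z 0 with rfl | hz0
  · simpa only [zero_mul] using ZeroMemClass.zero_mem (1 : FractionalIdeal R⁰ K)
  obtain ⟨k, hk⟩ := exists_hasOrder_of_ne_zero v hz0
  have hkI : ∀ n ∈ valueSet v I, k + n = 0 ∨ k + n = 4 ∨ k + n = 5 ∨ 7 ≤ k + n := fun n hn =>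
    (mem_valueSet_one_iff (R := R) _).1
      (valueSet_mono hz (add_mem_valueSet_spanSingleton_mul hk hn))
  have h36 : 3 ∈ valueSet v I ∨ 6 ∈ valueSet v I := by
    rcases eq_or_ne 3 g with rfl | h3
    · exact .inr ((hI.Ici_subset (by simp)).resolve_left (by simp))
    · exact .inl ((hI.Ici_subset (by simp)).resolve_left h3)
  have hk4 : 4 ≤ k := by
    have := hkI 0 hI.zero_mem
    have := h36.imp (hkI 3) (hkI 6)
    omega
  exact valIdeal_seven_le_one
    (valIdeal_anti (by lia) (mul_mem_valIdeal (hk.mem_valIdeal_iff.2 hk4) hx))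

theorem divClosure_eq (hI : IsNormalizedWithGap (valueSet v I) g) :
    divClosure I = I ⊔ valIdeal R v 3 := by
  have hdiv : divClosure (I ⊔ valIdeal R v 3) = I ⊔ valIdeal R v 3 := by
    refine divClosure_eq_self_of_Ici_subset (v := v)
      (sup_le (le_valIdeal_iff.2 hI.subset_Ici) (valIdeal_anti (by lia)))
      (valueSet_mono le_sup_left hI.zero_mem) (valIdeal_le_iff.1 le_sup_right)
  exact le_antisymm ((divClosure_mono le_sup_left).trans hdiv.le)
    (sup_le (le_divClosure I) hI.valIdeal_three_le_divClosure)

theorem valueSet_divClosure (hI : IsNormalizedWithGap (valueSet v I) g) :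
    valueSet v (divClosure I) = insert g (valueSet v I) := by
  rw [hI.divClosure_eq, valueSet_sup_valIdeal]
  refine subset_antisymm (Set.union_subset (Set.subset_insert _ _) hI.Ici_subset) ?_
  exact Set.insert_subset (.inr hI.three_le_gap) Set.subset_union_left

theorem covBy_divClosure (hI : IsNormalizedWithGap (valueSet v I) g) : I ⋖ divClosure I := by
  refine ⟨lt_of_le_not_ge (le_divClosure I) fun h => hI.gap_notMem <| valueSet_mono h <|
    hI.valueSet_divClosure ▸ Set.mem_insert _ _, fun J hIJ hJ => ?_⟩
  have hJ_values := (valueSet_mono (v := v) hJ.le).trans hI.valueSet_divClosure.subset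
  by_cases hg : g ∈ valueSet v J
  · exact hJ.ne (eq_of_le_of_valueSet_subset hJ.le
      (hI.valueSet_divClosure.trans_subset (Set.insert_subset hg (valueSet_mono hIJ.le))))
  · exact hIJ.ne (eq_of_le_of_valueSet_subset (v := v) hIJ.le fun n hn =>
      (hJ_values hn).resolve_left fun h => hg (h ▸ hn))

/-- A multiple of `J` that contains `I` but not the elements of order `g` must have its gap at
`g`. -/
theorem exists_le_spanSingleton_mul_iff (hI : IsNormalizedWithGap (valueSet v I) g)
    (hJ : IsNormalizedWithGap (valueSet v J) h) :
    (∃ c : K, c ≠ 0 ∧ I ≤ spanSingleton R⁰ c * J ∧ ¬ divClosure I ≤ spanSingleton R⁰ c * J) ↔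
      ∃ w, HasOrder v w (h - g) ∧ spanSingleton R⁰ w * I ≤ J := by
  constructor
  · rintro ⟨c, hc, hle, hnle⟩
    obtain ⟨m, hm⟩ := exists_hasOrder_of_ne_zero v hc
    have hIJ : ∀ n ∈ valueSet v I, n - m ∈ valueSet v J := fun n hn =>
      (valueSet_spanSingleton_mul hm).1 (valueSet_mono hle hn)
    have hgJ : g - m ∉ valueSet v J := by
      refine fun hgJ => hnle (hI.divClosure_eq ▸ sup_le hle (valIdeal_le_iff.2 ?_))
      refine hI.Ici_subset.trans fun n hn => (valueSet_spanSingleton_mul hm).2 ?_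
      exact hn.elim (fun h => h ▸ hgJ) (hIJ n)
    have hm0 : 0 ≤ 0 - m := hJ.subset_Ici (hIJ 0 hI.zero_mem)
    have hg3 := hI.three_le_gap
    have hgh : g - m = h := (hJ.Ici_subset (show 3 ≤ g - m by lia)).resolve_right hgJ
    refine ⟨c⁻¹, ?_, (spanSingleton_mul_le_iff_le_inv_mul (inv_ne_zero hc)).2 (by rwa [inv_inv])⟩
    convert hm.inv using 1
    lia
  · rintro ⟨w, hw, hwI⟩
    refine ⟨w⁻¹, inv_ne_zero hw.ne_zero, (spanSingleton_mul_le_iff_le_inv_mul hw.ne_zero).1 hwI,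
      fun hle => hJ.gap_notMem ?_⟩
    have hg : g ∈ valueSet v (divClosure I) := hI.valueSet_divClosure ▸ Set.mem_insert g _
    have := (valueSet_spanSingleton_mul hw.inv).1 (valueSet_mono hle hg)
    rwa [sub_neg_eq_add, add_sub_cancel] at this

end IsNormalizedWithGap

end Gap

section Representatives

open HasValuesFourFiveSeven

variable {R K : Type*} [CommRing R] [IsDomain R] [Field K] [Algebra R K]
  {v : Valuation K ℤᵐ⁰} [HasValuesFourFiveSeven R v] {I : FractionalIdeal R⁰ K} {t u x : K}
  {n : ℤ} {i j : ℕ} {a : R}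

theorem hasOrder_one_add_mul_pow (ht : HasOrder v t 1) (hj : 0 < j) (a : R) :
    HasOrder v (1 + algebraMap R K a * t ^ j) 0 :=
  hasOrder_one.add_of_mem (algebraMap_mul_mem a
    ((ht.pow j).mem_valIdeal_iff (R := R).2 (by lia)))

variable [IsFractionRing R K]

variable (R t) in
/-- The canonical ideal `R + t³R`. -/
noncomputable def canonicalIdeal : FractionalIdeal R⁰ K :=
  spanSingleton R⁰ (t ^ 3) ⊔ 1

variable (R v u) in
/-- The ideal generated by `u` and the elements of order at least `4`. -/
noncomputable def truncatedIdeal : FractionalIdeal R⁰ K :=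
  spanSingleton R⁰ u ⊔ valIdeal R v 4

variable (v t i j a) in
/-- The ideal generated by `tⁱ`, `1 + a tʲ` and the elements of order at least `4`. For
`{i, j} = {1, 2}` it is a plane in the quotient of the valuation ring by these elements. -/
noncomputable def planeIdeal : FractionalIdeal R⁰ K :=
  spanSingleton R⁰ (t ^ i) ⊔ truncatedIdeal R v (1 + algebraMap R K a * t ^ j)

variable (R v t) in
/-- The ideal generated by `1`, `t`, `t²` and the elements of order at least `4`. -/
noncomputable def hyperplaneIdeal : FractionalIdeal R⁰ K :=
  spanSingleton R⁰ t ⊔ (spanSingleton R⁰ (t ^ 2) ⊔ truncatedIdeal R v 1)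

theorem valIdeal_four_le_truncatedIdeal : valIdeal R v 4 ≤ truncatedIdeal R v u := le_sup_right

theorem valueSet_spanSingleton_sup_of_valIdeal_four_le (hI : valIdeal R v 4 ≤ I)
    (hx : HasOrder v x n) (h0 : 0 ≤ n) (hn : n ∉ valueSet v I) :
    valueSet v (spanSingleton R⁰ x ⊔ I) = insert n (valueSet v I) :=
  valueSet_spanSingleton_sup hx hn fun _ hr =>
    hI (mul_mem_valIdeal (algebraMap_mem_valIdeal_four hr) (hx.mem_valIdeal_iff.2 h0))

theorem valueSet_truncatedIdeal (hu : HasOrder v u 0) :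
    valueSet v (truncatedIdeal R v u) = insert 0 (Set.Ici 4) := by
  rw [truncatedIdeal, valueSet_spanSingleton_sup_of_valIdeal_four_le le_rfl hu le_rfl
    (by simp [valueSet_valIdeal]), valueSet_valIdeal]

theorem valueSet_planeIdeal (ht : HasOrder v t 1) (hij : i + j = 3) (hi : 0 < i) (hj : 0 < j)
    (a : R) : valueSet v (planeIdeal v t i j a) = insert ↑i (insert 0 (Set.Ici 4)) := by
  have h := valueSet_truncatedIdeal (R := R) (hasOrder_one_add_mul_pow ht hj a)
  rw [planeIdeal, valueSet_spanSingleton_sup_of_valIdeal_four_le valIdeal_four_le_truncatedIdeal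
    (ht.pow i) (by lia) (by simp [h]; lia), h]

theorem valueSet_hyperplaneIdeal (ht : HasOrder v t 1) :
    valueSet v (hyperplaneIdeal R v t) = insert 1 (insert 2 (insert 0 (Set.Ici 4))) := by
  have h0 := valueSet_truncatedIdeal (R := R) (v := v) hasOrder_one
  have h2 : valueSet v (spanSingleton R⁰ (t ^ 2) ⊔ truncatedIdeal R v 1) =
      insert 2 (insert 0 (Set.Ici 4)) := by
    rw [valueSet_spanSingleton_sup_of_valIdeal_four_le valIdeal_four_le_truncatedIdeal (ht.pow 2)
      (by lia) (by simp [h0]), h0, Nat.cast_ofNat]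
  rw [hyperplaneIdeal, valueSet_spanSingleton_sup_of_valIdeal_four_le
    (valIdeal_four_le_truncatedIdeal.trans le_sup_right) ht (by lia) (by rw [h2]; simp), h2]

theorem mem_valueSet_canonicalIdeal (ht : HasOrder v t 1) :
    n ∈ valueSet v (canonicalIdeal R t) ↔ n = 0 ∨ 3 ≤ n ∧ n ≠ 6 := by
  rw [canonicalIdeal, valueSet_spanSingleton_sup (ht.pow 3)
    (by rw [mem_valueSet_one_iff]; lia) fun r hr =>
      valIdeal_seven_le_one (mul_mem_valIdeal (algebraMap_mem_valIdeal_four hr)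
        (ht.pow 3).mem_valIdeal), Set.mem_insert_iff, mem_valueSet_one_iff]
  lia

theorem isNormalizedWithGap_truncatedIdeal_one :
    IsNormalizedWithGap (valueSet v (truncatedIdeal R v 1)) 3 := by
  rw [valueSet_truncatedIdeal hasOrder_one]
  constructor <;> simp [Set.subset_def] <;> lia

theorem isNormalizedWithGap_planeIdeal (ht : HasOrder v t 1) (hij : i + j = 3) (hi : 0 < i)
    (hj : 0 < j) (a : R) : IsNormalizedWithGap (valueSet v (planeIdeal v t i j a)) 3 := by
  rw [valueSet_planeIdeal ht hij hi hj]
  constructor <;> simp [Set.subset_def] <;> lia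

theorem isNormalizedWithGap_hyperplaneIdeal (ht : HasOrder v t 1) :
    IsNormalizedWithGap (valueSet v (hyperplaneIdeal R v t)) 3 := by
  rw [valueSet_hyperplaneIdeal ht]
  constructor <;> simp [Set.subset_def] <;> lia

theorem isNormalizedWithGap_canonicalIdeal (ht : HasOrder v t 1) :
    IsNormalizedWithGap (valueSet v (canonicalIdeal R t)) 6 := by
  constructor <;> simp [Set.subset_def, mem_valueSet_canonicalIdeal ht] <;> lia

end Representatives

section Classification

open HasValuesFourFiveSeven

variable {R K : Type*} [CommRing R] [IsDomain R] [Field K] [Algebra R K] [IsFractionRing R K]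
  {v : Valuation K ℤᵐ⁰} [HasValuesFourFiveSeven R v] {I J : FractionalIdeal R⁰ K} {t u x : K}
  {i j : ℕ}

theorem spanSingleton_mul_truncatedIdeal_le_iff (hJ : valIdeal R v 4 ≤ J) (hu : HasOrder v u 0) :
    spanSingleton R⁰ u * truncatedIdeal R v x ≤ J ↔ u * x ∈ J := by
  rw [truncatedIdeal, spanSingleton_mul_spanSingleton_sup_le_iff, and_iff_left]
  exact spanSingleton_mul_le_iff.2 fun y hy =>
    hJ (zero_add (4 : ℤ) ▸ mul_mem_valIdeal hu.mem_valIdeal hy)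

namespace IsNormalizedWithGap

theorem exists_mul_truncatedIdeal_le (hI : IsNormalizedWithGap (valueSet v I) 3) :
    ∃ u, HasOrder v u 0 ∧ spanSingleton R⁰ u * truncatedIdeal R v 1 ≤ I := by
  obtain ⟨u, huI, hu⟩ := hI.zero_mem
  exact ⟨u, hu, (spanSingleton_mul_truncatedIdeal_le_iff hI.valIdeal_four_le hu).2
    (by rwa [mul_one])⟩

theorem exists_mul_le_hyperplaneIdeal (hI : IsNormalizedWithGap (valueSet v I) 3)
    (ht : HasOrder v t 1) :
    ∃ u, HasOrder v u 0 ∧ spanSingleton R⁰ u * I ≤ hyperplaneIdeal R v t := by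
  refine exists_hasOrder_spanSingleton_mul_le (g := 3) (le_valIdeal_iff.2 hI.subset_Ici) ?_
    hI.gap_notMem
  rw [valueSet_hyperplaneIdeal ht]
  intro n hn
  simp only [Set.mem_Ici, Set.mem_insert_iff] at hn ⊢
  lia

theorem exists_mul_le_canonicalIdeal (hI : IsNormalizedWithGap (valueSet v I) 3)
    (ht : HasOrder v t 1) :
    ∃ u, HasOrder v u 3 ∧ spanSingleton R⁰ u * I ≤ canonicalIdeal R t := by
  refine exists_hasOrder_spanSingleton_mul_le (g := 6) (le_valIdeal_iff.2 hI.subset_Ici) ?_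
    hI.gap_notMem
  intro n hn
  rw [Set.mem_Ici] at hn
  rw [Set.mem_insert_iff, mem_valueSet_canonicalIdeal ht]
  lia

theorem eq_mul_truncatedIdeal (hI : IsNormalizedWithGap (valueSet v I) 3)
    (h1 : 1 ∉ valueSet v I) (h2 : 2 ∉ valueSet v I) :
    ∃ u, HasOrder v u 0 ∧ I = spanSingleton R⁰ u * truncatedIdeal R v 1 := by
  obtain ⟨u, hu, hle⟩ := hI.exists_mul_truncatedIdeal_le
  refine ⟨u, hu, eq_spanSingleton_mul_of_le hu hle fun n hn => ?_⟩
  have h0 : 0 ≤ n := hI.subset_Ici hn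
  have h123 : n ≠ 1 ∧ n ≠ 2 ∧ n ≠ 3 :=
    ⟨ne_of_mem_of_not_mem hn h1, ne_of_mem_of_not_mem hn h2, ne_of_mem_of_not_mem hn hI.gap_notMem⟩
  rw [valueSet_truncatedIdeal hasOrder_one, Set.mem_insert_iff, Set.mem_Ici]
  lia

theorem eq_mul_hyperplaneIdeal (hI : IsNormalizedWithGap (valueSet v I) 3)
    (h1 : 1 ∈ valueSet v I) (h2 : 2 ∈ valueSet v I) (ht : HasOrder v t 1) :
    ∃ u, HasOrder v u 0 ∧ I = spanSingleton R⁰ u * hyperplaneIdeal R v t := by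
  obtain ⟨u, hu, hle⟩ := hI.exists_mul_le_hyperplaneIdeal ht
  have hle_inv := (spanSingleton_mul_le_iff_le_inv_mul hu.ne_zero).1 hle
  refine ⟨u⁻¹, neg_zero (G := ℤ) ▸ hu.inv,
    eq_of_le_of_valueSet_subset (v := v) hle_inv fun n hn => ?_⟩
  rw [valueSet_spanSingleton_mul hu.inv, valueSet_hyperplaneIdeal ht, neg_zero, sub_zero] at hn
  have h4 := valIdeal_le_iff.1 hI.valIdeal_four_le
  exact Set.insert_subset h1 (Set.insert_subset h2 (Set.insert_subset hI.zero_mem h4)) hn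

theorem eq_mul_canonicalIdeal (hI : IsNormalizedWithGap (valueSet v I) 6) (ht : HasOrder v t 1) :
    ∃ u, HasOrder v u 0 ∧ I = spanSingleton R⁰ u * canonicalIdeal R t := by
  obtain ⟨u, huI, hu⟩ := hI.zero_mem
  obtain ⟨y, hyI, hy⟩ := (hI.Ici_subset (Set.mem_Ici.2 le_rfl)).resolve_left (by lia)
  obtain ⟨r, hr⟩ := exists_sub_mul_mem (R := R) (w := t ^ 3 * y) (y := t ^ 3 * u)
    ((ht.pow 3).mul hy) hI.Ici_subset (by simpa using ((ht.pow 3).mul hu).mem_valIdeal (R := R))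
  have hry : algebraMap R K r * y ∈ valIdeal R v 3 := algebraMap_mul_mem r hy.mem_valIdeal
  have hu' := hu.sub_of_mem (valIdeal_anti (by lia) hry)
  refine ⟨_, hu', eq_spanSingleton_mul_of_le hu' ?_ fun n hn => ?_⟩
  · rw [canonicalIdeal, spanSingleton_mul_spanSingleton_sup_le_iff, mul_one,
      spanSingleton_le_iff_mem]
    refine ⟨?_, sub_mem huI (algebraMap_mul_mem r hyI)⟩
    convert hr using 1
    ring
  · have h0 : 0 ≤ n := hI.subset_Ici hn
    have h1 : n ≠ 1 := by
      rintro rfl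
      exact hI.gap_notMem (add_mem_valueSet (R := R) (n := 5) hn (by lia))
    have h2 : n ≠ 2 := by
      rintro rfl
      exact hI.gap_notMem (add_mem_valueSet (R := R) (n := 4) hn (by lia))
    have h6 : n ≠ 6 := ne_of_mem_of_not_mem hn hI.gap_notMem
    rw [mem_valueSet_canonicalIdeal ht]
    lia

theorem exists_sub_mul_pow_mem_sup (hI : IsNormalizedWithGap (valueSet v I) 3)
    (ht : HasOrder v t 1) (hij : i + j = 3) (hi0 : 0 < i) (hj0 : 0 < j)
    (hi : (i : ℤ) ∈ valueSet v I) (hu : HasOrder v u 0) :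
    ∃ r : R, u - algebraMap R K r * (u * t ^ j) ∈ I ⊔ valIdeal R v 3 := by
  have hut : HasOrder v (u * t ^ j) j := by simpa only [zero_add] using hu.mul (ht.pow j)
  refine exists_sub_mul_mem hut (fun n hn => ?_) hu.mem_valIdeal
  rw [Set.mem_Ici] at hn
  rw [valueSet_sup_valIdeal]
  obtain rfl | rfl | rfl | h3 : n = 0 ∨ n = i ∨ n = j ∨ 3 ≤ n := by lia
  exacts [.inr (.inl hI.zero_mem), .inr (.inl hi), .inl rfl, .inr (.inr h3)]

/-- The elements of orders `i` and `0` of `I` determine `u` and `a`: the first one is `u tⁱ`, up to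
order `4`, and the second one is `u + a u tʲ`, up to order `3`. -/
theorem exists_eq_mul_planeIdeal (hI : IsNormalizedWithGap (valueSet v I) 3)
    (ht : HasOrder v t 1) (hij : i + j = 3) (hi0 : 0 < i) (hj0 : 0 < j)
    (hi : (i : ℤ) ∈ valueSet v I) (hj : (j : ℤ) ∉ valueSet v I) :
    ∃ (a : R) (u : K), HasOrder v u 0 ∧ ∀ b : R, algebraMap R K (b - a) ∈ valIdeal R v 1 →
      I = spanSingleton R⁰ u * planeIdeal v t i j b := by
  obtain ⟨y, hyI, hy⟩ := hi
  set u₀ : K := y * (t ^ i)⁻¹ with hu₀_def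
  have hu₀ : HasOrder v u₀ 0 := by simpa only [add_neg_cancel] using hy.mul (ht.pow i).inv
  have hw : HasOrder v (u₀ * t ^ j) j := by simpa only [zero_add] using hu₀.mul (ht.pow j)
  obtain ⟨r, hr⟩ := hI.exists_sub_mul_pow_mem_sup ht hij hi0 hj0 (hy.mem_valueSet hyI) hu₀
  rw [sup_eq_add, mem_add] at hr
  obtain ⟨x, hxI, f, hf, hxf⟩ := hr
  have hu : HasOrder v (u₀ - f) 0 := hu₀.sub_of_mem (valIdeal_anti (by lia) hf)
  refine ⟨-r, _, hu, fun b hb => eq_spanSingleton_mul_of_le hu ?_ fun n hn => ?_⟩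
  · have hft (k : ℕ) (hk : 0 < k) : f * t ^ k ∈ I :=
      hI.valIdeal_four_le (valIdeal_anti (by lia) (mul_mem_valIdeal hf (ht.pow k).mem_valIdeal))
    have hbw : algebraMap R K (b - -r) * (u₀ * t ^ j) ∈ I := hI.valIdeal_four_le
      (valIdeal_anti (by lia) (mul_mem_valIdeal (algebraMap_mem_valIdeal_four hb) hw.mem_valIdeal))
    rw [planeIdeal, spanSingleton_mul_spanSingleton_sup_le_iff,
      spanSingleton_mul_truncatedIdeal_le_iff hI.valIdeal_four_le hu]
    constructor
    · rw [sub_mul, hu₀_def, inv_mul_cancel_right₀ (ht.pow i).ne_zero]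
      exact sub_mem hyI (hft i hi0)
    · convert add_mem (sub_mem hxI (algebraMap_mul_mem b (hft j hj0))) hbw using 1
      rw [map_sub, map_neg]
      linear_combination -hxf
  · have h0 : 0 ≤ n := hI.subset_Ici hn
    have hj3 : n ≠ j ∧ n ≠ 3 := ⟨ne_of_mem_of_not_mem hn hj, ne_of_mem_of_not_mem hn hI.gap_notMem⟩
    rw [valueSet_planeIdeal ht hij hi0 hj0, Set.mem_insert_iff, Set.mem_insert_iff, Set.mem_Ici]
    lia

end IsNormalizedWithGap

end Classification

section Transversal

open HasValuesFourFiveSeven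

section ResidueField

variable {R K : Type*} [CommRing R] [IsDomain R] [IsLocalRing R] [Field K] [Algebra R K]
  {v : Valuation K ℤᵐ⁰} [IsResiduallyRational R v] {r : R}

theorem algebraMap_mem_valIdeal_one_iff :
    algebraMap R K r ∈ valIdeal R v 1 ↔ r ∈ IsLocalRing.maximalIdeal R := by
  have not_isUnit_of_mem : ∀ {r : R}, algebraMap R K r ∈ valIdeal R v 1 → ¬ IsUnit r := by
    rintro r hr ⟨u, rfl⟩
    have h := algebraMap_mul_mem ↑u⁻¹ hr
    rw [← map_mul, Units.inv_mul, map_one, hasOrder_one.mem_valIdeal_iff] at h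
    lia
  rw [IsLocalRing.mem_maximalIdeal]
  refine ⟨not_isUnit_of_mem, fun hr => by_contra fun hr1 => ?_⟩
  have hr0 := hasOrder_of_mem_of_notMem (algebraMap_mem_valIdeal_zero r) hr1
  obtain ⟨s, hs⟩ := hr0.exists_sub_mem (hasOrder_one.mem_valIdeal (R := R))
  rw [← map_mul, ← map_one (algebraMap R K), ← map_sub] at hs
  refine (IsLocalRing.isUnit_or_isUnit_one_sub_self (s * r)).elim ?_ (not_isUnit_of_mem hs)
  exact fun h => hr (isUnit_of_mul_isUnit_right h)

theorem residue_eq_residue_iff {a b : R} : IsLocalRing.residue R a = IsLocalRing.residue R b ↔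
    algebraMap R K (a - b) ∈ valIdeal R v 1 := by
  rw [algebraMap_mem_valIdeal_one_iff, ← IsLocalRing.residue_eq_zero_iff, map_sub, sub_eq_zero]

end ResidueField

variable {R K : Type*} [CommRing R] [IsDomain R] [Field K] [Algebra R K] [IsFractionRing R K]
  {v : Valuation K ℤᵐ⁰} [HasValuesFourFiveSeven R v] {I : FractionalIdeal R⁰ K} {t u : K}
  {g : ℤ} {i j : ℕ} {a b : R}

theorem exists_sub_mem_valIdeal_of_mul_pow_mem (ht : HasOrder v t 1) (hij : i + j = 3)
    (hi : 0 < i) (hj : 0 < j) (hu : HasOrder v u 0) (huti : u * t ^ i ∈ planeIdeal v t i j b) :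
    ∃ d : R, HasOrder v (algebraMap R K d) 0 ∧ u - algebraMap R K d ∈ valIdeal R v (j + 1) := by
  obtain ⟨d, hd⟩ := hasOrder_one.exists_sub_mem (hu.mem_valIdeal (R := R))
  rw [mul_one] at hd
  refine ⟨d, by simpa only [sub_sub_cancel] using hu.sub_of_mem hd, ?_⟩
  rcases eq_or_ne (u - algebraMap R K d) 0 with h0 | h0
  · exact h0 ▸ zero_mem _
  obtain ⟨k, hk⟩ := exists_hasOrder_of_ne_zero v h0
  have hk1 : 0 + 1 ≤ k := hk.mem_valIdeal_iff.1 hd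
  have hti : t ^ i ∈ planeIdeal v t i j b :=
    le_sup_left (b := truncatedIdeal R v _) (mem_spanSingleton_self R⁰ _)
  have hmem : (u - algebraMap R K d) * t ^ i ∈ planeIdeal v t i j b := by
    rw [sub_mul]
    exact sub_mem huti (algebraMap_mul_mem d hti)
  have hki := (hk.mul (ht.pow i)).mem_valueSet hmem
  rw [valueSet_planeIdeal ht hij hi hj, Set.mem_insert_iff, Set.mem_insert_iff,
    Set.mem_Ici] at hki
  exact hk.mem_valIdeal_iff.2 (by lia)

/-- Comparing `u (1 + a tʲ)` with `d (1 + b tʲ)` for a constant `d` that agrees with `u` up to order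
`j`. -/
theorem sub_mem_valIdeal_of_mul_planeIdeal_le (ht : HasOrder v t 1) (hij : i + j = 3)
    (hi : 0 < i) (hj : 0 < j) (hu : HasOrder v u 0)
    (hle : spanSingleton R⁰ u * planeIdeal v t i j a ≤ planeIdeal v t i j b) :
    algebraMap R K (a - b) ∈ valIdeal R v 1 := by
  rw [planeIdeal, spanSingleton_mul_spanSingleton_sup_le_iff,
    spanSingleton_mul_truncatedIdeal_le_iff
      (isNormalizedWithGap_planeIdeal ht hij hi hj b).valIdeal_four_le hu] at hle
  obtain ⟨huti, hua⟩ := hle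
  obtain ⟨d, hd, hud⟩ := exists_sub_mem_valIdeal_of_mul_pow_mem ht hij hi hj hu huti
  by_contra hab
  have hb : 1 + algebraMap R K b * t ^ j ∈ planeIdeal v t i j b :=
    le_sup_right (a := spanSingleton R⁰ _) <| le_sup_left (b := valIdeal R v 4) <|
      mem_spanSingleton_self R⁰ _
  have hab0 := hasOrder_of_mem_of_notMem (algebraMap_mem_valIdeal_zero (a - b)) hab
  have hud_mul := mul_mem_valIdeal hud (hasOrder_one_add_mul_pow ht hj a).mem_valIdeal
  have hdiff : HasOrder v (u * (1 + algebraMap R K a * t ^ j) -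
      algebraMap R K d * (1 + algebraMap R K b * t ^ j)) j := by
    convert ((hd.mul hab0).mul (ht.pow j)).add_of_mem (R := R) (valIdeal_anti (by lia) hud_mul)
      using 1
    · rw [map_sub]
      ring
    · lia
  have := hdiff.mem_valueSet (sub_mem hua (algebraMap_mul_mem d hb))
  rw [valueSet_planeIdeal ht hij hi hj, Set.mem_insert_iff, Set.mem_insert_iff,
    Set.mem_Ici] at this
  lia

theorem divClosure_eq_self_of_notMem (hI : I ≤ valIdeal R v 0) (h0 : 0 ∈ valueSet v I)
    (h3 : 3 ∉ valueSet v I) (h6 : 6 ∉ valueSet v I) : divClosure I = I := by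
  obtain ⟨u, huI, hu⟩ := h0
  obtain rfl : I = spanSingleton R⁰ u * 1 := by
    refine eq_spanSingleton_mul_of_le hu ?_ fun n hn => ?_
    · rwa [mul_one, spanSingleton_le_iff_mem]
    have hn0 : 0 ≤ n := le_valIdeal_iff.1 hI hn
    have hn3 : n ≠ 3 ∧ n ≠ 6 := ⟨ne_of_mem_of_not_mem hn h3, ne_of_mem_of_not_mem hn h6⟩
    have hn1 : n ≠ 1 := by
      rintro rfl
      exact h6 (add_mem_valueSet (R := R) (n := 5) hn (by lia))
    have hn2 : n ≠ 2 := by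
      rintro rfl
      exact h6 (add_mem_valueSet (R := R) (n := 4) hn (by lia))
    rw [mem_valueSet_one_iff]
    lia
  rw [divClosure_spanSingleton_mul hu.ne_zero, divClosure_one]

theorem divClosure_eq_or_isNormalizedWithGap (hI : I ≤ valIdeal R v 0) (h0 : 0 ∈ valueSet v I) :
    divClosure I = I ∨ ∃ g, IsNormalizedWithGap (valueSet v I) g := by
  have mem_of_semigroup {n : ℤ} (hn : n = 0 ∨ n = 4 ∨ n = 5 ∨ 7 ≤ n) : n ∈ valueSet v I :=
    add_zero n ▸ add_mem_valueSet h0 hn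
  have mem_or {n : ℤ} (hn : n ∈ Set.Ici 3) : n = 3 ∨ n = 6 ∨ n ∈ valueSet v I := by
    by_cases hn' : n = 0 ∨ n = 4 ∨ n = 5 ∨ 7 ≤ n
    · exact .inr (.inr (mem_of_semigroup hn'))
    · rw [Set.mem_Ici] at hn
      lia
  have hI0 := le_valIdeal_iff.1 hI
  by_cases h3 : 3 ∈ valueSet v I <;> by_cases h6 : 6 ∈ valueSet v I
  · refine .inl (divClosure_eq_self_of_Ici_subset hI h0 fun n hn => ?_)
    rcases mem_or hn with rfl | rfl | hn
    exacts [h3, h6, hn]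
  · refine .inr ⟨6, hI0, h0, h6, fun n hn => ?_, by lia⟩
    rcases mem_or hn with rfl | rfl | hn
    exacts [.inr h3, .inl rfl, .inr hn]
  · refine .inr ⟨3, hI0, h0, h3, fun n hn => ?_, le_rfl⟩
    rcases mem_or hn with rfl | rfl | hn
    exacts [.inl rfl, .inr h6, .inr hn]
  · exact .inl (divClosure_eq_self_of_notMem hI h0 h3 h6)

theorem exists_eq_spanSingleton_mul_normalized (v : Valuation K ℤᵐ⁰) [HasValuesFourFiveSeven R v]
    (hI : I ≠ 0) : ∃ c : K, ∃ J : FractionalIdeal R⁰ K, c ≠ 0 ∧ J ≤ valIdeal R v 0 ∧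
      0 ∈ valueSet v J ∧ I = spanSingleton R⁰ c * J := by
  obtain ⟨m, hm⟩ := exists_le_valIdeal v I
  obtain ⟨n, hn, hn_min⟩ := Int.exists_least_of_bdd
    ⟨m, fun k hk => le_valIdeal_iff.1 hm hk⟩ (nonempty_valueSet v hI)
  obtain ⟨x, -, hx⟩ := id hn
  refine ⟨x, spanSingleton R⁰ x⁻¹ * I, hx.ne_zero, le_valIdeal_iff.2 fun k hk => ?_,
    (valueSet_spanSingleton_mul hx.inv).2 (by simpa only [sub_neg_eq_add, zero_add] using hn), ?_⟩
  · have := hn_min _ ((valueSet_spanSingleton_mul hx.inv).1 hk)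
    rw [Set.mem_Ici]
    lia
  · simpa only [inv_inv] using (spanSingleton_inv_mul_cancel (inv_ne_zero hx.ne_zero) I).symm

section Rep

open NondivisorialClass

variable [IsLocalRing R]

variable (R) in
/-- The representatives `rep v t x` of the nondivisorial classes, for a uniformizer `t`. The two
families of planes, with values `{0, 1}` and `{0, 2}`, are both parametrized by the residue
field. -/
noncomputable def rep (v : Valuation K ℤᵐ⁰) [HasValuesFourFiveSeven R v] (t : K) :
    NondivisorialClass (IsLocalRing.ResidueField R ⊕ IsLocalRing.ResidueField R) →
      FractionalIdeal R⁰ K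
  | .least => truncatedIdeal R v 1
  | .plane (.inl a) => planeIdeal v t 1 2 (Function.surjInv IsLocalRing.residue_surjective a)
  | .plane (.inr a) => planeIdeal v t 2 1 (Function.surjInv IsLocalRing.residue_surjective a)
  | .hyperplane => hyperplaneIdeal R v t
  | .canonical => canonicalIdeal R t

theorem isNormalizedWithGap_rep (ht : HasOrder v t 1)
    (x : NondivisorialClass (IsLocalRing.ResidueField R ⊕ IsLocalRing.ResidueField R)) :
    IsNormalizedWithGap (valueSet v (rep R v t x)) x.gap := by
  rcases x with - | (a | a) | - | -
  exacts [isNormalizedWithGap_truncatedIdeal_one,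
    isNormalizedWithGap_planeIdeal ht rfl one_pos two_pos _,
    isNormalizedWithGap_planeIdeal ht rfl two_pos one_pos _,
    isNormalizedWithGap_hyperplaneIdeal ht, isNormalizedWithGap_canonicalIdeal ht]

variable {x y : NondivisorialClass (IsLocalRing.ResidueField R ⊕ IsLocalRing.ResidueField R)}

theorem exists_mul_rep_le (ht : HasOrder v t 1) (h : x ≤ y) :
    ∃ w, HasOrder v w (y.gap - x.gap) ∧ spanSingleton R⁰ w * rep R v t x ≤ rep R v t y := by
  rcases h with rfl | h
  · exact ⟨1, by rw [sub_self]; exact hasOrder_one, by rw [spanSingleton_one, one_mul]⟩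
  have hx := isNormalizedWithGap_rep ht x
  have hy := isNormalizedWithGap_rep ht y
  rcases y with - | y | - | -
  · exact absurd h (Nat.not_lt_zero _)
  · obtain rfl : x = .least := by rcases x with - | _ | - | - <;> simp_all [height]
    exact hy.exists_mul_truncatedIdeal_le
  · rw [gap_eq_three (x := x) (by rintro rfl; simp [height] at h)] at hx ⊢
    exact hx.exists_mul_le_hyperplaneIdeal ht
  · rw [gap_eq_three (x := x) (by rintro rfl; simp [height] at h)] at hx ⊢
    exact hx.exists_mul_le_canonicalIdeal ht

theorem eq_of_mul_planeIdeal_le {a b : IsLocalRing.ResidueField R} (ht : HasOrder v t 1)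
    (hij : i + j = 3) (hi : 0 < i) (hj : 0 < j) (hu : HasOrder v u 0)
    (hle : spanSingleton R⁰ u *
        planeIdeal v t i j (Function.surjInv IsLocalRing.residue_surjective a) ≤
      planeIdeal v t i j (Function.surjInv IsLocalRing.residue_surjective b)) : a = b := by
  rw [← Function.surjInv_eq IsLocalRing.residue_surjective a,
    ← Function.surjInv_eq IsLocalRing.residue_surjective b]
  exact residue_eq_residue_iff.2 (sub_mem_valIdeal_of_mul_planeIdeal_le ht hij hi hj hu hle)

theorem le_of_mul_rep_le (ht : HasOrder v t 1) (hu : HasOrder v u (y.gap - x.gap))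
    (hle : spanSingleton R⁰ u * rep R v t x ≤ rep R v t y) : x ≤ y := by
  have h0 : 0 ≤ y.gap - x.gap := by
    simpa only [add_zero, Set.mem_Ici] using (isNormalizedWithGap_rep ht y).subset_Ici
      (valueSet_mono hle
        (add_mem_valueSet_spanSingleton_mul hu (isNormalizedWithGap_rep ht x).zero_mem))
  by_cases hy : y = .canonical
  · rcases eq_or_ne x .canonical with hx | hx
    exacts [(hx.trans hy.symm).le, hy ▸ (lt_canonical_iff.2 hx).le]
  have hx : x ≠ .canonical := by
    rintro rfl
    rw [gap_eq_three hy, gap] at h0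
    lia
  rw [gap_eq_three hx, gap_eq_three hy, sub_self] at hu
  have hvalues := valueSet_subset_of_spanSingleton_mul_le hu hle
  have hvalues_inl := valueSet_planeIdeal (R := R) ht (show 1 + 2 = 3 from rfl) one_pos two_pos
  have hvalues_inr := valueSet_planeIdeal (R := R) ht (show 2 + 1 = 3 from rfl) two_pos one_pos
  have eq_inl (a b) (hxa : x = .plane (.inl a)) (hyb : y = .plane (.inl b)) : a = b := by
    subst hxa hyb
    exact eq_of_mul_planeIdeal_le ht rfl one_pos two_pos hu hle
  have eq_inr (a b) (hxa : x = .plane (.inr a)) (hyb : y = .plane (.inr b)) : a = b := by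
    subst hxa hyb
    exact eq_of_mul_planeIdeal_le ht rfl two_pos one_pos hu hle
  clear hle
  rcases x with - | (a | a) | - | - <;> rcases y with - | (b | b) | - | - <;>
    simp only [rep, valueSet_truncatedIdeal hasOrder_one, hvalues_inl, hvalues_inr,
      valueSet_hyperplaneIdeal ht] at hvalues <;>
    simp_all [Set.insert_subset_iff, le_iff, height]

theorem exists_eq_mul_rep (ht : HasOrder v t 1) (hI : IsNormalizedWithGap (valueSet v I) g) :
    ∃ x u, HasOrder v u 0 ∧ I = spanSingleton R⁰ u * rep R v t x := by
  rcases eq_or_ne g 3 with rfl | hg3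
  · by_cases h1 : 1 ∈ valueSet v I <;> by_cases h2 : 2 ∈ valueSet v I
    · exact ⟨.hyperplane, hI.eq_mul_hyperplaneIdeal h1 h2 ht⟩
    · obtain ⟨a, u, hu, hIu⟩ := hI.exists_eq_mul_planeIdeal ht rfl one_pos two_pos h1 h2
      exact ⟨.plane (.inl (IsLocalRing.residue R a)), u, hu, hIu _ (residue_eq_residue_iff.1
        (Function.surjInv_eq _ _))⟩
    · obtain ⟨a, u, hu, hIu⟩ := hI.exists_eq_mul_planeIdeal ht rfl two_pos one_pos h2 h1
      exact ⟨.plane (.inr (IsLocalRing.residue R a)), u, hu, hIu _ (residue_eq_residue_iff.1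
        (Function.surjInv_eq _ _))⟩
    · exact ⟨.least, hI.eq_mul_truncatedIdeal h1 h2⟩
  · obtain rfl := hI.gap_eq.resolve_left hg3
    exact ⟨.canonical, hI.eq_mul_canonicalIdeal ht⟩

theorem isNondivisorialTransversal_rep (ht : HasOrder v t 1) :
    IsNondivisorialTransversal (rep R v t) where
  divClosure_eq_or_exists I := by
    rcases eq_or_ne I 0 with rfl | hI
    · exact .inl divClosure_zero
    obtain ⟨c, J, hc, hJ, hJ0, rfl⟩ := exists_eq_spanSingleton_mul_normalized v hI
    refine (divClosure_eq_or_isNormalizedWithGap hJ hJ0).imp (fun h => ?_) fun ⟨g, hg⟩ => ?_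
    · rw [divClosure_spanSingleton_mul hc, h]
    · obtain ⟨x, u, hu, rfl⟩ := exists_eq_mul_rep ht hg
      exact ⟨x, c * u, mul_ne_zero hc hu.ne_zero, by
        rw [← mul_assoc, spanSingleton_mul_spanSingleton]⟩
  covBy x := (isNormalizedWithGap_rep ht x).covBy_divClosure
  le_iff x y := by
    rw [(isNormalizedWithGap_rep ht x).exists_le_spanSingleton_mul_iff
      (isNormalizedWithGap_rep ht y)]
    exact ⟨exists_mul_rep_le ht, fun ⟨w, hw, hle⟩ => le_of_mul_rep_le ht hw hle⟩

end Rep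

end Transversal

theorem mem_closure_four_five_seven (n : ℕ) :
    n ∈ AddSubmonoid.closure ({4, 5, 7} : Set ℕ) ↔ n = 0 ∨ n = 4 ∨ n = 5 ∨ 7 ≤ n := by
  constructor
  · intro h
    induction h using AddSubmonoid.closure_induction with
    | mem x hx =>
      simp only [Set.mem_insert_iff, Set.mem_singleton_iff] at hx
      lia
    | zero => exact .inl rfl
    | add x y _ _ hx hy => lia
  · have h4 : 4 ∈ AddSubmonoid.closure ({4, 5, 7} : Set ℕ) :=
      AddSubmonoid.subset_closure (by simp)
    have h5 : 5 ∈ AddSubmonoid.closure ({4, 5, 7} : Set ℕ) :=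
      AddSubmonoid.subset_closure (by simp)
    have h7 : 7 ∈ AddSubmonoid.closure ({4, 5, 7} : Set ℕ) :=
      AddSubmonoid.subset_closure (by simp)
    rintro (rfl | rfl | rfl | h)
    · exact zero_mem _
    · exact h4
    · exact h5
    · induction n using Nat.strong_induction_on with
      | _ n ih =>
        by_cases h11 : n < 11
        · obtain rfl | rfl | rfl | rfl : n = 7 ∨ n = 4 + 4 ∨ n = 4 + 5 ∨ n = 5 + 5 := by lia
          exacts [h7, add_mem h4 h4, add_mem h4 h5, add_mem h5 h5]
        · obtain ⟨m, rfl⟩ : ∃ m, n = m + 4 := ⟨n - 4, by lia⟩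
          exact add_mem (ih m (by lia) (by lia)) h4

section DiscreteValuationRing

open IsDedekindDomain IsDiscreteValuationRing

variable {R V K : Type*} [CommRing R] [CommRing V] [IsDomain V] [IsDiscreteValuationRing V]
  [Field K] [Algebra V K] [IsFractionRing V K]

variable (V K) in
/-- The normalized valuation of the quotient field of a discrete valuation ring. -/
noncomputable abbrev normalizedValuation : Valuation K ℤᵐ⁰ :=
  (maximalIdeal V).valuation K

theorem hasOrder_algebraMap_iff {x : V} {n : ℕ} :
    HasOrder (normalizedValuation V K) (algebraMap V K x) n ↔ addVal V x = n := by
  obtain ⟨ϖ, hϖ⟩ := exists_irreducible V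
  have hϖ_order : HasOrder (normalizedValuation V K) (algebraMap V K ϖ) 1 := by
    rw [HasOrder, HeightOneSpectrum.valuation_of_algebraMap,
      HeightOneSpectrum.intValuation_singleton _ hϖ.ne_zero hϖ.maximalIdeal_eq]
  rcases eq_or_ne x 0 with rfl | hx
  · rw [addVal_zero, map_zero]
    exact iff_of_false (fun h => h.ne_zero rfl) (ENat.top_ne_natCast n)
  obtain ⟨k, u, rfl⟩ := eq_unit_mul_pow_irreducible hx hϖ
  have hu : HasOrder (normalizedValuation V K) (algebraMap V K u) 0 := by
    rw [HasOrder, neg_zero, exp_zero, HeightOneSpectrum.valuation_eq_one_iff_notMem]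
    exact (IsLocalRing.notMem_maximalIdeal).2 u.isUnit
  have hk : HasOrder (normalizedValuation V K) (algebraMap V K (u * ϖ ^ k)) k := by
    rw [map_mul, map_pow]
    simpa only [zero_add] using hu.mul (hϖ_order.pow k)
  rw [addVal_def' u hϖ k, Nat.cast_inj]
  exact ⟨fun h => by exact_mod_cast hk.unique h, fun h => h ▸ hk⟩

variable [Algebra R K]

theorem exists_algebraMap_eq_of_conductor {x : K} (hx : x ≠ 0)
    (hxV : ∀ z : V, ∃ r : R, algebraMap R K r = x * algebraMap V K z) {y : K}
    (hyx : normalizedValuation V K y ≤ normalizedValuation V K x) :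
    ∃ r : R, algebraMap R K r = y := by
  obtain ⟨z, hz⟩ := exists_lift_of_le_one (A := V) (x := y / x) <| by
    rw [map_div₀]
    exact div_le_one_of_le₀ hyx zero_le
  obtain ⟨r, hr⟩ := hxV z
  exact ⟨r, by rw [hr, hz, mul_div_cancel₀ y hx]⟩

variable [Algebra R V] [IsScalarTower R V K]

theorem map_algebraMap_le_one_of_isScalarTower (r : R) :
    normalizedValuation V K (algebraMap R K r) ≤ 1 := by
  rw [IsScalarTower.algebraMap_apply R V K]
  exact HeightOneSpectrum.valuation_le_one _ _

theorem exists_map_sub_lt_of_residueField_surjective [IsLocalRing R] [IsLocalHom (algebraMap R V)]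
    (hres : Function.Surjective (IsLocalRing.ResidueField.map (algebraMap R V))) {x y : K}
    (hx : x ≠ 0) (hyx : normalizedValuation V K y ≤ normalizedValuation V K x) :
    ∃ r : R, normalizedValuation V K (y - algebraMap R K r * x) < normalizedValuation V K x := by
  obtain ⟨z, hz⟩ := exists_lift_of_le_one (A := V) (x := y / x) <| by
    rw [map_div₀]
    exact div_le_one_of_le₀ hyx zero_le
  obtain ⟨a, ha⟩ := hres (IsLocalRing.residue V z)
  obtain ⟨r, rfl⟩ := IsLocalRing.residue_surjective a
  rw [IsLocalRing.ResidueField.map_residue, eq_comm, ← sub_eq_zero, ← map_sub,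
    IsLocalRing.residue_eq_zero_iff] at ha
  refine ⟨r, ?_⟩
  have hlt : normalizedValuation V K (algebraMap V K (z - algebraMap R V r)) < 1 :=
    (HeightOneSpectrum.valuation_lt_one_iff_mem _ _).2 ha
  rw [map_sub, hz, ← IsScalarTower.algebraMap_apply] at hlt
  rw [← div_mul_cancel₀ y hx, ← sub_mul, map_mul]
  exact mul_lt_of_lt_one_left (zero_lt_iff.2 ((Valuation.ne_zero_iff _).2 hx)) hlt

theorem mem_valueSet_one_iff_mem_valueSemigroup (n : ℤ) :
    n ∈ valueSet (normalizedValuation V K) (1 : FractionalIdeal R⁰ K) ↔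
      ∃ m ∈ valueSemigroup R V, (m : ℤ) = n := by
  constructor
  · rintro ⟨_, hr, hrn⟩
    obtain ⟨r, rfl⟩ := (mem_one_iff _).1 hr
    have hn : 0 ≤ n := by
      have := hrn.symm.trans_le (map_algebraMap_le_one_of_isScalarTower r)
      rwa [← exp_zero, exp_le_exp, neg_nonpos] at this
    lift n to ℕ using hn
    rw [IsScalarTower.algebraMap_apply R V K] at hrn
    exact ⟨n, ⟨r, hasOrder_algebraMap_iff.1 hrn⟩, rfl⟩
  · rintro ⟨m, ⟨r, hr⟩, rfl⟩
    refine HasOrder.mem_valueSet ?_ (coe_mem_one R⁰ r)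
    rw [IsScalarTower.algebraMap_apply R V K]
    exact hasOrder_algebraMap_iff.2 hr

end DiscreteValuationRing

section KunzDomain

variable {R V K : Type*} [CommRing R] [IsDomain R] [IsLocalRing R]
  [CommRing V] [IsDomain V] [IsDiscreteValuationRing V] [Field K]
  [Algebra R V] [Algebra R K] [Algebra V K] [IsScalarTower R V K] [IsFractionRing V K]

theorem IsKunzDomain.isResiduallyRational (hR : IsKunzDomain R V K) :
    IsResiduallyRational R (normalizedValuation V K) where
  exists_hasOrder_one := IsDedekindDomain.HeightOneSpectrum.valuation_exists_uniformizer K _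
  map_algebraMap_le_one := map_algebraMap_le_one_of_isScalarTower
  exists_map_sub_lt _ _ hx hyx :=
    have := hR.isLocalHom
    exists_map_sub_lt_of_residueField_surjective hR.residueField_bijective.2 hx hyx
  exists_conductor := by
    obtain ⟨x, hx, hxV⟩ := hR.conductor_ne_zero
    obtain ⟨n, hn⟩ := exists_hasOrder_of_ne_zero (normalizedValuation V K) hx
    exact ⟨n, fun y hy => exists_algebraMap_eq_of_conductor hx hxV (hy.trans hn.ge)⟩

theorem IsKunzDomain.hasValuesFourFiveSeven (hR : IsKunzDomain R V K)
    (hS : valueSemigroup R V = AddSubmonoid.closure {4, 5, 7}) :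
    HasValuesFourFiveSeven R (normalizedValuation V K) where
  toIsResiduallyRational := hR.isResiduallyRational
  mem_valueSet_one_iff n := by
    rw [mem_valueSet_one_iff_mem_valueSemigroup (V := V), hS]
    simp only [mem_closure_four_five_seven]
    constructor
    · rintro ⟨m, hm, rfl⟩
      lia
    · exact fun hn => ⟨n.toNat, by lia, by lia⟩

end KunzDomain

theorem mainTheorem5_general (R V K : Type*) [CommRing R] [IsDomain R] [IsLocalRing R]
    [CommRing V] [IsDomain V] [IsDiscreteValuationRing V] [Field K]
    [Algebra R V] [Algebra R K] [Algebra V K] [IsScalarTower R V K] [IsFractionRing R K]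
    (hR : IsKunzDomain R V K) (hS : valueSemigroup R V = AddSubmonoid.closure {4, 5, 7}) :
    Nonempty (StarOperation R K ≃
      Set (IsLocalRing.ResidueField R ⊕ IsLocalRing.ResidueField R) ⊕ Fin 3) := by
  have := hR.isFractionRing_right
  have := hR.hasValuesFourFiveSeven hS
  obtain ⟨t, ht⟩ := exists_hasOrder R (normalizedValuation V K) 1
  exact NondivisorialClass.nonempty_lowerSet_equiv.map
    (isNondivisorialTransversal_rep ht).starOperationEquiv.trans

theorem mainTheorem5 (R V K : Type*) [CommRing R] [IsDomain R] [IsLocalRing R]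
    [CommRing V] [IsDomain V] [IsDiscreteValuationRing V] [Field K]
    [Algebra R V] [Algebra R K] [Algebra V K] [IsScalarTower R V K] [IsFractionRing R K]
    (hR : IsKunzDomain R V K)
    (hS : valueSemigroup R V = AddSubmonoid.closure {4, 5, 7})
    (q : ℕ) [Finite (IsLocalRing.ResidueField R)]
    (hq : Nat.card (IsLocalRing.ResidueField R) = q) :
    Finite (StarOperation R K) ∧ Nat.card (StarOperation R K) = 2 ^ (2 * q) + 3 := by
  obtain ⟨e⟩ := mainTheorem5_general R V K hR hS
  have := Fintype.ofFinite (IsLocalRing.ResidueField R)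
  exact ⟨.of_equiv _ e.symm, by simp [Nat.card_congr e, ← hq, two_mul]⟩
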